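/- Let $p\ge 1$ be an integer, let $d_1,d_2,a_1,a_2,b_1,b_2>0$, let $f,g,h,\delta\in\ell^2=\ell^2(\mathbb Z)$ (real sequences), and let $\sigma_i:\mathbb R\to\mathbb R$ ($i\in\mathbb Z$) satisfy, for constants $L_\sigma>0$ and $\beta\in\mathbb R$, $$|\sigma_i(s_1)-\sigma_i(s_2)|\le L_\sigma|s_1-s_2|,\qquad |\sigma_i(s)|\le\delta_i+\beta|s|,\qquad \min(a_1,a_2)>16\beta^2 .$$ Let $X=\ell^2\times\ell^2$ with the norm $\|(u,v)\|_X^2=b_2\|u\|^2+b_1\|v\|^2$, and $(Au)_i=-u_{i-1}+2u_i-u_{i+1}$. The backward Euler–Maruyama (BEM) scheme with time step $\Delta>0$ for the random lattice reversible Selkov system is, for $i\in\mathbb Z$, $$\begin{aligned}u_{m+1,i}&=u_{m,i}+\Delta\big(-d_1(Au_{m+1})_i-a_1u_{m+1,i}+b_1u_{m+1,i}^{2p}v_{m+1,i}-b_2u_{m+1,i}^{2p+1}+f_i\big)+(h_i+\sigma_i(u_{m,i}))\,\Delta W_m,\\ v_{m+1,i}&=v_{m,i}+\Delta\big(-d_2(Av_{m+1})_i-a_2v_{m+1,i}-b_1u_{m+1,i}^{2p}v_{m+1,i}+b_2u_{m+1,i}^{2p+1}+g_i\big)+(h_i+\sigma_i(v_{m,i}))\,\Delta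 W_m,\end{aligned}$$ where the increments $\Delta W_m\sim N(0,\Delta)$ of a scalar Wiener process are independent of the past. Its truncation of order $N$ is the same system for $|i|\le N$ on $\mathbb R^{2N+1}\times\mathbb R^{2N+1}$, with $A$ replaced by the periodic discrete Laplacian $A_N$ on $\{-N,\dots,N\}$ (the neighbours of $N$ are $N-1$ and $-N$; those of $-N$ are $N$ and $-N+1$). A probability measure $\mu$ on the state space is called an invariant measure of such a scheme if, on some probability space, there are a random state $\psi_0$ of law $\mu$, a random variable $\Delta W\sim N(0,\Delta)$ independent of $\psi_0$, and a random state $\psi_1$ of law $\mu$ such that almost surely $\psi_1$ solves the scheme for one step from $\psi_0$ with increment $\Delta W$. (When the implicit equation always has exactly one solution, depending measurably on $(\psi_0,\Delta W)$, this is invariance under the transition operator of the Markov chain $\psi_m$.) Let $S^{\Delta}$ be the set of invariant measures of the BEM scheme on $X$, and let $S^{\Delta,N}$ be the set of invariant measures of the truncation, regarded as probability measures on $X$ via extension of vectors by zero. For probability measures on $X$ put $$d_{P(X)}(\mu,\nu)=\sup\Big\{\Big|\int\varphi\,d\mu-\int\varphi\,d\nu\Big| : \|\varphi\|_\infty+\mathrm{Lip}(\varphi)\le1\Big\},\qquad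 d_{P(X)}(S,T)=\sup_{\mu\in S}\inf_{\nu\in T}d_{P(X)}(\mu,\nu),$$ with $\mathrm{Lip}$ taken with respect to $\|\cdot\|_X$, $\inf\emptyset=\infty$ and $\sup\emptyset=0$. **Theorem.** There is $\Delta^*>0$, not depending on $N$, such that for every $\Delta\in(0,\Delta^*)$ $$\lim_{N\to\infty}d_{P(X)}\big(S^{\Delta,N},S^{\Delta}\big)=0 .$$ -/

import Mathlib

open MeasureTheory ProbabilityTheory Filter Topology

noncomputable section

namespace LatticeSelkov

/-- The Hilbert space of real square-summable bi-infinite sequences. -/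
abbrev Ell2 : Type := lp (fun _ : ℤ => ℝ) 2

/-- The Borel σ-algebra. -/
instance : MeasurableSpace Ell2 := borel Ell2

instance : BorelSpace Ell2 := ⟨rfl⟩

/-- The phase space `ℓ² × ℓ²` (the product σ-algebra is the Borel one, as `ℓ²` is separable). -/
abbrev PhaseSpace : Type := Ell2 × Ell2

/-- The data of the random lattice reversible Selkov system. -/
structure SelkovData where
  /-- the reaction exponent: the nonlinearities are `u^(2p) v` and `u^(2p+1)` -/
  p : ℕ
  d₁ : ℝ
  d₂ : ℝ
  a₁ : ℝ
  a₂ : ℝ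
  b₁ : ℝ
  b₂ : ℝ
  /-- external forces `f`, `g` and noise intensities `h`, `σ` -/
  f : Ell2
  g : Ell2
  h : Ell2
  σ : ℤ → ℝ → ℝ

/-- The weighted norm `‖(u, v)‖ = (b₂ ‖u‖² + b₁ ‖v‖²)^(1/2)` of the phase space. -/
def SelkovData.normX (D : SelkovData) (ψ : PhaseSpace) : ℝ :=
  Real.sqrt (D.b₂ * ‖ψ.1‖ ^ 2 + D.b₁ * ‖ψ.2‖ ^ 2)

/-- One step of the backward Euler-Maruyama scheme on sites indexed by `ι`, written in coordinates:
`(u', v')` solves the implicit equations of the scheme with time step `Δ`, discrete Laplacian `A`,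
previous state `(u, v)` and Wiener increment `w`. Here `e i` is the lattice point of the site `i`. -/
def SelkovData.BEMStepOn (D : SelkovData) {ι : Type} (e : ι → ℤ) (A : (ι → ℝ) → ι → ℝ) (Δ : ℝ)
    (u v : ι → ℝ) (w : ℝ) (u' v' : ι → ℝ) : Prop :=
  (∀ i : ι, u' i = u i - D.d₁ * A u' i * Δ - D.a₁ * u' i * Δ
      + D.b₁ * (u' i ^ (2 * D.p) * v' i) * Δ - D.b₂ * u' i ^ (2 * D.p + 1) * Δ
      + D.f (e i) * Δ + (D.h (e i) + D.σ (e i) (u i)) * w) ∧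
  (∀ i : ι, v' i = v i - D.d₂ * A v' i * Δ - D.a₂ * v' i * Δ
      - D.b₁ * (u' i ^ (2 * D.p) * v' i) * Δ + D.b₂ * u' i ^ (2 * D.p + 1) * Δ
      + D.g (e i) * Δ + (D.h (e i) + D.σ (e i) (v i)) * w)

/-- `(A u)_i = -u_{i-1} + 2 u_i - u_{i+1}` on `ℤ`. -/
def laplacian (u : ℤ → ℝ) (i : ℤ) : ℝ :=
  -u (i - 1) + 2 * u i - u (i + 1)

/-- The sites `-N, …, N`. -/
abbrev sites (N : ℕ) : Set ℤ := Set.Icc (-(N : ℤ)) N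

/-- Extension by zero of a vector indexed by `-N, …, N`. -/
def zeroExt {N : ℕ} (u : sites N → ℝ) (i : ℤ) : ℝ :=
  if hi : i ∈ sites N then u ⟨i, hi⟩ else 0

/-- The discrete Laplacian on `-N, …, N` with periodic boundary conditions (for `N ≥ 1`). -/
def periodicLaplacian (N : ℕ) (u : sites N → ℝ) (i : sites N) : ℝ :=
  if (i : ℤ) = N then
    -zeroExt u (N - 1) + 2 * zeroExt u N - zeroExt u (-N)
  else if (i : ℤ) = -N then
    -zeroExt u N + 2 * zeroExt u (-N) - zeroExt u (-N + 1)
  else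
    -zeroExt u (i - 1) + 2 * zeroExt u i - zeroExt u (i + 1)

theorem zeroExt_mem {N : ℕ} (u : sites N → ℝ) : Memℓp (zeroExt u) 2 := by
  have h0 : Memℓp (zeroExt u) 0 := by
    apply memℓp_zero
    refine (Set.finite_Icc (-(N : ℤ)) N).subset ?_
    intro i hi
    by_contra hc
    exact hi (dif_neg hc)
  exact h0.of_exponent_ge zero_le

/-- The state space `ℝ^(2N+1) × ℝ^(2N+1)` of the truncated scheme. -/
abbrev FinState (N : ℕ) : Type := (sites N → ℝ) × (sites N → ℝ)

/-- The embedding of the truncated state space into `ℓ² × ℓ²` by zero extension. -/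
def embed (N : ℕ) (x : FinState N) : PhaseSpace :=
  (⟨zeroExt x.1, zeroExt_mem x.1⟩, ⟨zeroExt x.2, zeroExt_mem x.2⟩)

/-- One step of the scheme on the whole lattice. -/
def SelkovData.BEMStep (D : SelkovData) (Δ : ℝ) (x : PhaseSpace) (w : ℝ) (y : PhaseSpace) : Prop :=
  D.BEMStepOn id laplacian Δ x.1 x.2 w y.1 y.2

/-- One step of the `(2N+1)`-dimensional periodic truncation of the scheme. -/
def SelkovData.BEMStepTrunc (D : SelkovData) (N : ℕ) (Δ : ℝ) (x : FinState N) (w : ℝ)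
    (y : FinState N) : Prop :=
  D.BEMStepOn (fun i : sites N => (i : ℤ)) (periodicLaplacian N) Δ x.1 x.2 w y.1 y.2

/-- `μ` is an invariant measure of the implicit scheme `step`, driven by independent `N(0, Δ)`
increments: from a random state `ψ₀` of law `μ` and an increment `w` independent of it, the scheme
has a solution `ψ₁` of law `μ`. An implicit equation need not have exactly one solution for each
state and each increment, so the next state is not presupposed to be a function of `(ψ₀, w)`;
where it is one, this is invariance under the transition kernel
(`isInvariantLaw_iff_of_unique`). -/
def IsInvariantLaw {S : Type} [MeasurableSpace S] (step : S → ℝ → S → Prop) (Δ : ℝ)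
    (μ : ProbabilityMeasure S) : Prop :=
  ∃ (Ω : Type) (_ : MeasurableSpace Ω) (P : Measure Ω) (_ : IsProbabilityMeasure P)
    (ψ₀ : Ω → S) (w : Ω → ℝ) (ψ₁ : Ω → S),
    Measurable ψ₀ ∧ Measurable w ∧ Measurable ψ₁ ∧
    P.map ψ₀ = μ ∧ P.map w = gaussianReal 0 Δ.toNNReal ∧ IndepFun ψ₀ w P ∧
    P.map ψ₁ = μ ∧ ∀ᵐ ω ∂P, step (ψ₀ ω) (w ω) (ψ₁ ω)

/-- If the scheme has exactly one solution, `Φ (x, w)`, then the invariant measures are those of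
the Markov kernel that sends `x` to the law of `Φ (x, w)` with `w` of law `N(0, Δ)`. -/
theorem isInvariantLaw_iff_of_unique {S : Type} [MeasurableSpace S] (step : S → ℝ → S → Prop)
    (Δ : ℝ) (μ : ProbabilityMeasure S) (Φ : S × ℝ → S) (hΦ : Measurable Φ)
    (hstep : ∀ x w y, step x w y ↔ y = Φ (x, w)) :
    IsInvariantLaw step Δ μ ↔
      ((Kernel.id ×ₖ Kernel.const S (gaussianReal 0 Δ.toNNReal)).map Φ).Invariant μ := by
  have key : (μ : Measure S).bind
      ((Kernel.id ×ₖ Kernel.const S (gaussianReal 0 Δ.toNNReal)).map Φ) =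
      ((μ : Measure S).prod (gaussianReal 0 Δ.toNNReal)).map Φ := by
    rw [← Measure.compProd_const, Measure.compProd_eq_comp_prod, Measure.map_comp _ _ hΦ]
  unfold Kernel.Invariant
  rw [key]
  constructor
  · rintro ⟨Ω, _, P, _, ψ₀, w, ψ₁, h0, hw, h1, e0, ew, hi, e1, hs⟩
    rw [indepFun_iff_map_prod_eq_prod_map_map h0.aemeasurable hw.aemeasurable, e0, ew] at hi
    rw [← hi, Measure.map_map hΦ (h0.prodMk hw), ← e1]
    refine Measure.map_congr ?_
    filter_upwards [hs] with ω h
    exact ((hstep _ _ _).1 h).symm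
  · intro h
    refine ⟨S × ℝ, inferInstance, (μ : Measure S).prod (gaussianReal 0 Δ.toNNReal), inferInstance,
      Prod.fst, Prod.snd, Φ, measurable_fst, measurable_snd, hΦ, ?_, ?_, ?_, h, ?_⟩
    · simp
    · simp
    · rw [indepFun_iff_map_prod_eq_prod_map_map measurable_fst.aemeasurable
        measurable_snd.aemeasurable]
      simp
    · exact Eventually.of_forall fun ω => (hstep _ _ _).2 rfl

/-- The invariant measures of the scheme on `ℓ² × ℓ²`. -/
def SelkovData.invMeasures (D : SelkovData) (Δ : ℝ) : Set (ProbabilityMeasure PhaseSpace) :=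
  {μ | IsInvariantLaw (D.BEMStep Δ) Δ μ}

/-- The invariant measures of the truncated scheme, regarded as probability measures on
`ℓ² × ℓ²` through the zero extension. -/
def SelkovData.truncInvMeasures (D : SelkovData) (Δ : ℝ) (N : ℕ) :
    Set (ProbabilityMeasure PhaseSpace) :=
  {μ | ∃ ν : ProbabilityMeasure (FinState N),
    IsInvariantLaw (D.BEMStepTrunc N Δ) Δ ν ∧
      (μ : Measure PhaseSpace) = (ν : Measure (FinState N)).map (embed N)}

/-- The functions `φ` with `‖φ‖_∞ + Lip φ ≤ 1`, for the weighted norm of the phase space. -/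
def SelkovData.unitBL (D : SelkovData) : Set (PhaseSpace → ℝ) :=
  {φ | ∃ M L : ℝ, M + L ≤ 1 ∧ 0 ≤ L ∧ (∀ x, |φ x| ≤ M) ∧
    ∀ x y, |φ x - φ y| ≤ L * D.normX (x - y)}

/-- The bounded-Lipschitz (dual) metric on probability measures. -/
def SelkovData.distP (D : SelkovData) (μ ν : ProbabilityMeasure PhaseSpace) : ENNReal :=
  ⨆ φ ∈ D.unitBL, ENNReal.ofReal |(∫ x, φ x ∂(μ : Measure PhaseSpace)) -
    ∫ x, φ x ∂(ν : Measure PhaseSpace)|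

/-- The Hausdorff semi-distance of `S` from `T`; it is infinite if `T` is empty and `S` is not. -/
def SelkovData.semidistP (D : SelkovData) (S T : Set (ProbabilityMeasure PhaseSpace)) : ENNReal :=
  ⨆ μ ∈ S, ⨅ ν ∈ T, D.distP μ ν

end LatticeSelkov

end

noncomputable section

namespace LatticeSelkov

open scoped BoundedContinuousFunction

/-! The argument is compactness plus closedness. All invariant measures of all truncations with `N ≥
1` form one tight family, and every weak limit point of them as `N → ∞` is invariant for the full
lattice. If the semi-distance did not tend to zero, some truncated invariant measures would stay
away from `S^Δ` along infinitely many `N`, while a limit point of them lies in `S^Δ`.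

Tightness rests on an energy with weights `w |i|` tending to infinity, whose sublevel sets are
compact in `ℓ²` (`isCompact_weightedEllipsoid`). The weight is chosen after the data: it grows so
slowly that the weighted forcing stays summable and that the Laplacian, no longer positive for the
weighted product, costs only part of the linear damping (`exists_weight`,
`sum_weight_mul_periodicLaplacian_ge`). In the pairing that defines the norm the reaction terms have
a good sign (`site_energy_le`). Hence one step contracts the mean energy up to a constant
independent of `N`, and stationarity turns this into a tail bound
(`IsInvariantLaw.measure_le_of_lyapunov`).

Closedness is proved for joint laws of (state, increment, next state), so no unique solvability of
the implicit equation is needed. Stationarity, independence and the equation at each fixed site are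
closed conditions under weak convergence (`SelkovData.exists_mem_invMeasures_tendsto`). -/

/-! ### Bounded-Lipschitz and Lévy-Prokhorov distances -/

/-- A quantitative comparison of the bounded-Lipschitz and the Lévy-Prokhorov distances. -/
theorem integral_sub_le_of_levyProkhorovEDist_lt {X : Type*} [PseudoMetricSpace X]
    [MeasurableSpace X] [OpensMeasurableSpace X] (μ ν : Measure X) [IsProbabilityMeasure μ]
    [IsProbabilityMeasure ν] {ε M c : ℝ} (hε : 0 < ε)
    (h : levyProkhorovEDist μ ν < ENNReal.ofReal ε) (hM : 0 ≤ M) (hc : 0 ≤ c) {φ : X → ℝ}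
    (hφ : ∀ x, |φ x| ≤ M) (hL : ∀ x y, |φ x - φ y| ≤ c * dist x y) :
    ∫ x, φ x ∂μ - ∫ x, φ x ∂ν ≤ (c + 2 * M) * ε := by
  have hcont : Continuous φ :=
    (LipschitzWith.of_dist_le_mul (K := c.toNNReal) fun x y => by
      rw [Real.coe_toNNReal c hc, Real.dist_eq]; exact hL x y).continuous
  -- The layer-cake bound needs a nonnegative function; the shift by `M` costs a norm of at most `2
  -- * M`.
  let f : X →ᵇ ℝ := BoundedContinuousFunction.ofNormedAddCommGroup (fun x => φ x + M)
    (by fun_prop) (2 * M) (fun x => by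
      rw [Real.norm_eq_abs, abs_le]; have := abs_le.1 (hφ x); constructor <;> linarith)
  have hf : ∀ x, f x = φ x + M := fun x => rfl
  have hf0 : ∀ x, 0 ≤ f x := fun x => by rw [hf]; linarith [(abs_le.1 (hφ x)).1]
  have hfn : ‖f‖ ≤ 2 * M := BoundedContinuousFunction.norm_ofNormedAddCommGroup_le _ (by linarith) _
  have h1 := BoundedContinuousFunction.integral_le_of_levyProkhorovEDist_lt μ ν hε h f
    (Eventually.of_forall hf0)
  have hint : ∀ (ρ : Measure X) [IsProbabilityMeasure ρ], Integrable φ ρ := fun ρ _ =>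
    Integrable.of_bound hcont.measurable.aestronglyMeasurable M
      (Eventually.of_forall fun x => hφ x)
  have hcε : 0 ≤ c * ε := by positivity
  have h2 : ∫ x, (f x + c * ε) ∂ν
      = ∫ t in Set.Ioc 0 (‖f‖ + c * ε), ν.real {a : X | t ≤ f a + c * ε} := by
    refine Integrable.integral_eq_integral_Ioc_meas_le ?_ ?_ ?_
    · exact (f.integrable ν).add (integrable_const _)
    · exact Eventually.of_forall fun x => add_nonneg (hf0 x) hcε
    · refine Eventually.of_forall fun x => ?_
      simpa using f.apply_le_norm x
  have hio : ∀ (A : ℝ → Set X) (r : ℝ), Antitone A →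
      IntegrableOn (fun t => ν.real (A t)) (Set.Ioc 0 r) := by
    intro A r hA
    apply Measure.integrableOn_of_bounded (M := 1) measure_Ioc_lt_top.ne
    · apply (Measurable.ennreal_toReal (Antitone.measurable ?_)).aestronglyMeasurable
      exact fun _ _ hst ↦ measure_mono (hA hst)
    · refine Eventually.of_forall fun t ↦ ?_
      simp only [Real.norm_eq_abs, abs_of_nonneg measureReal_nonneg]
      exact measureReal_le_one
  have hA1 : Antitone fun t : ℝ => {a : X | t ≤ f a + c * ε} := fun _ _ hst _ h => hst.trans h
  have hA2 : Antitone fun t : ℝ => Metric.thickening ε {a : X | t ≤ f a} := fun _ _ hst =>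
    Metric.thickening_subset_of_subset ε (fun _ h => hst.trans h)
  -- On the `ε`-thickening of `{t ≤ f}` the Lipschitz bound gives `t ≤ f + c * ε`. Enlarging the
  -- range of `t` by `c * ε` then makes the right side the exact layer-cake formula for `f + c * ε`.
  have h3 : ∫ t in Set.Ioc 0 ‖f‖, ν.real (Metric.thickening ε {a | t ≤ f a})
      ≤ ∫ t in Set.Ioc 0 (‖f‖ + c * ε), ν.real {a : X | t ≤ f a + c * ε} := by
    calc _ ≤ ∫ t in Set.Ioc 0 ‖f‖, ν.real {a : X | t ≤ f a + c * ε} := by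
          refine setIntegral_mono (hio _ _ hA2) (hio _ _ hA1) fun t => ?_
          refine measureReal_mono (fun a ha => ?_) (measure_ne_top _ _)
          obtain ⟨z, hz, hd⟩ := Metric.mem_thickening_iff.1 ha
          have e1 := abs_le.1 (hL a z)
          have e2 : c * dist a z ≤ c * ε := mul_le_mul_of_nonneg_left hd.le hc
          simp only [Set.mem_ofPred_eq, hf] at hz ⊢
          linarith
      _ ≤ _ := by
          refine setIntegral_mono_set (hio _ _ hA1)
            (Eventually.of_forall fun t => measureReal_nonneg) ?_
          exact (Set.Ioc_subset_Ioc_right (by linarith)).eventuallyLE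
  rw [← h2] at h3
  have e1 : ∫ x, f x ∂μ = ∫ x, φ x ∂μ + M := by
    simp only [hf]; rw [integral_add (hint μ) (integrable_const _)]; simp
  have e2 : ∫ x, (f x + c * ε) ∂ν = ∫ x, φ x ∂ν + M + c * ε := by
    simp only [hf, add_assoc]
    rw [integral_add (hint ν) (integrable_const _)]
    simp
  rw [e1] at h1; rw [e2] at h3
  nlinarith [mul_le_mul_of_nonneg_left hfn hε.le]

/-! ### Separability and compact sets of `ℓ²` -/

instance : SecondCountableTopology Ell2 := by
  have hd : Dense (Submodule.span ℝ (Set.range fun i : ℤ => lp.single (E := fun _ : ℤ => ℝ) 2 i (1 : ℝ)) : Set Ell2) := by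
    intro x
    have hs := lp.hasSum_single (E := fun _ : ℤ => ℝ) (p := 2) (by norm_num) x
    refine mem_closure_of_tendsto hs (Eventually.of_forall fun s => ?_)
    refine Submodule.sum_mem _ fun i _ => ?_
    have : lp.single (E := fun _ : ℤ => ℝ) 2 i (x i) = x i • lp.single (E := fun _ : ℤ => ℝ) 2 i (1 : ℝ) := by
      rw [← lp.single_smul]; simp
    rw [this]
    exact Submodule.smul_mem _ _ (Submodule.subset_span ⟨i, rfl⟩)
  have hsep : TopologicalSpace.IsSeparable (Submodule.span ℝ (Set.range fun i : ℤ => lp.single (E := fun _ : ℤ => ℝ) 2 i (1 : ℝ)) : Set Ell2) :=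
    (Set.countable_range _).isSeparable.span
  have : TopologicalSpace.SeparableSpace Ell2 := by
    rw [← TopologicalSpace.isSeparable_univ_iff, ← hd.closure_eq]
    exact hsep.closure
  exact UniformSpace.secondCountable_of_separable Ell2

theorem Ell2.continuous_apply (i : ℤ) : Continuous fun x : Ell2 => x i :=
  (lp.lipschitzWith_one_eval 2 i).continuous

theorem Ell2.summable_sq (x : Ell2) : Summable fun i => x i ^ 2 := by
  have := (lp.memℓp x).summable (by norm_num)
  simpa using this

theorem Ell2.norm_le_of_sum_sq_le {x : Ell2} {C : ℝ} (hC : 0 ≤ C)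
    (h : ∀ s : Finset ℤ, ∑ i ∈ s, x i ^ 2 ≤ C ^ 2) : ‖x‖ ≤ C := by
  refine lp.norm_le_of_forall_sum_le (by norm_num) hC fun s => ?_
  simpa using h s

/-- Along an ultrafilter the coordinates converge by boundedness, and the finite-sum constraints
pass to the limit. Growth of the weight makes the tails uniformly small, which upgrades
coordinatewise to norm convergence. -/
theorem isCompact_weightedEllipsoid {w : ℕ → ℝ} (hw1 : ∀ k, 1 ≤ w k)
    (hw : Tendsto w atTop atTop) (R : ℝ) :
    IsCompact {x : Ell2 | ∀ s : Finset ℤ, ∑ i ∈ s, w i.natAbs * x i ^ 2 ≤ R} := by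
  set K := {x : Ell2 | ∀ s : Finset ℤ, ∑ i ∈ s, w i.natAbs * x i ^ 2 ≤ R} with hK
  have hw0 : ∀ k, 0 < w k := fun k => zero_lt_one.trans_le (hw1 k)
  rw [isCompact_iff_ultrafilter_le_nhds]
  intro 𝓕 h𝓕
  have hmem : ∀ᶠ x in (𝓕 : Filter Ell2), x ∈ K := le_principal_iff.1 h𝓕
  have hR : 0 ≤ R := by
    obtain ⟨x, hx⟩ := hmem.exists
    simpa using hx ∅
  have hcoord : ∀ i : ℤ, ∃ y : ℝ, Tendsto (fun x : Ell2 => x i) 𝓕 (𝓝 y) := by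
    intro i
    have hb : ∀ᶠ x in (𝓕 : Filter Ell2), x i ∈ Set.Icc (-(R + 1)) (R + 1) := by
      filter_upwards [hmem] with x hx
      have h1 := hx {i}
      rw [Finset.sum_singleton] at h1
      refine abs_le.1 (abs_le_of_sq_le_sq ?_ (by linarith))
      nlinarith [hw1 i.natAbs, sq_nonneg (x i)]
    obtain ⟨y, -, hy⟩ := isCompact_iff_ultrafilter_le_nhds.1
      (isCompact_Icc (a := -(R + 1)) (b := R + 1)) (𝓕.map fun x : Ell2 => x i)
      (le_principal_iff.2 hb)
    exact ⟨y, hy⟩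
  choose y hy using hcoord
  have hyK : ∀ s : Finset ℤ, ∑ i ∈ s, w i.natAbs * y i ^ 2 ≤ R := fun s =>
    le_of_tendsto (tendsto_finsetSum s fun i _ => ((hy i).pow 2).const_mul _)
      (hmem.mono fun x hx => hx s)
  have hymem : Memℓp y 2 := by
    refine memℓp_gen' (C := R) fun s => ?_
    refine le_trans (Finset.sum_le_sum fun i _ => ?_) (hyK s)
    have := sq_nonneg (y i)
    simp only [Real.norm_eq_abs, ENNReal.toReal_ofNat, Real.rpow_ofNat, sq_abs]
    nlinarith [hw1 i.natAbs]
  refine ⟨⟨y, hymem⟩, hyK, ?_⟩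
  change Tendsto (fun x : Ell2 => x) 𝓕 (𝓝 (⟨y, hymem⟩ : Ell2))
  rw [tendsto_iff_norm_sub_tendsto_zero]
  rw [Metric.tendsto_nhds]
  intro ε hε
  -- With this threshold the sites beyond `n` contribute at most `ε ^ 2 / 4` to the squared
  -- distance, as do the finitely many others. `R + 1` avoids dividing by zero.
  obtain ⟨n, hn⟩ := eventually_atTop.1 (hw.eventually_ge_atTop (16 * (R + 1) / ε ^ 2))
  have hfin : ∀ᶠ x in (𝓕 : Filter Ell2),
      ∑ i ∈ Finset.Icc (-(n : ℤ)) n, (x i - y i) ^ 2 < ε ^ 2 / 4 := by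
    have : Tendsto (fun x : Ell2 => ∑ i ∈ Finset.Icc (-(n : ℤ)) n, (x i - y i) ^ 2) 𝓕
        (𝓝 (∑ i ∈ Finset.Icc (-(n : ℤ)) n, (y i - y i) ^ 2)) :=
      tendsto_finsetSum _ fun i _ => ((hy i).sub_const _).pow 2
    simp only [sub_self, ne_eq, OfNat.ofNat_ne_zero, not_false_eq_true, zero_pow,
      Finset.sum_const_zero] at this
    exact this.eventually_lt_const (by positivity)
  filter_upwards [hmem, hfin] with x hx hxf
  rw [Real.dist_eq, sub_zero, abs_of_nonneg (norm_nonneg _)]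
  refine lt_of_le_of_lt (Ell2.norm_le_of_sum_sq_le (C := ε * (3 / 4)) (by positivity) fun s => ?_)
    (by linarith)
  have hsplit : ∑ i ∈ s, (x i - y i) ^ 2 ≤ ∑ i ∈ Finset.Icc (-(n : ℤ)) n, (x i - y i) ^ 2
      + ∑ i ∈ s, ε ^ 2 / (16 * (R + 1)) * (2 * (w i.natAbs * x i ^ 2) + 2 * (w i.natAbs * y i ^ 2)) := by
    rw [← Finset.sum_filter_add_sum_filter_not s (fun i => i ∈ Finset.Icc (-(n : ℤ)) n)]
    refine add_le_add ?_ ?_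
    · refine Finset.sum_le_sum_of_subset_of_nonneg ?_ fun _ _ _ => sq_nonneg _
      intro i hi; exact (Finset.mem_filter.1 hi).2
    · refine le_trans (Finset.sum_le_sum fun i hi => ?_)
        (Finset.sum_le_sum_of_subset_of_nonneg (Finset.filter_subset _ _) fun i _ _ => ?_)
      · have hi' := (Finset.mem_filter.1 hi).2
        rw [Finset.mem_Icc, not_and_or] at hi'
        have hwn := hn i.natAbs (by omega)
        rw [div_le_iff₀ (by positivity)] at hwn
        have e : (x i - y i) ^ 2 ≤ 2 * x i ^ 2 + 2 * y i ^ 2 := by nlinarith [sq_nonneg (x i + y i)]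
        refine e.trans ?_
        rw [show ε ^ 2 / (16 * (R + 1)) * (2 * (w i.natAbs * x i ^ 2) + 2 * (w i.natAbs * y i ^ 2))
          = (w i.natAbs * ε ^ 2 / (16 * (R + 1))) * (2 * x i ^ 2 + 2 * y i ^ 2) by ring]
        refine le_mul_of_one_le_left (by positivity) ?_
        rw [le_div_iff₀ (by positivity)]; linarith
      · have := hw0 i.natAbs; positivity
  have hb : ∑ i ∈ s, ε ^ 2 / (16 * (R + 1)) * (2 * (w i.natAbs * x i ^ 2) + 2 * (w i.natAbs * y i ^ 2))
      ≤ ε ^ 2 / 4 := by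
    rw [← Finset.mul_sum, Finset.sum_add_distrib, ← Finset.mul_sum, ← Finset.mul_sum]
    have h1 := hx s
    have h2 := hyK s
    rw [div_mul_eq_mul_div, div_le_iff₀ (by positivity)]
    nlinarith [sq_nonneg ε]
  have : ∀ i, (x - (⟨y, hymem⟩ : Ell2)) i = x i - y i := fun i => rfl
  simp only [this]
  nlinarith

/-! ### Slowly growing weights adapted to the data -/

/-- The weight is one plus a sum of ramps `min 1 (k / K n)`. A long ramp has small slope and, by
dominated convergence, carries little `F`-mass, so both can be made geometrically small in `n`.
Every ramp eventually equals one, hence the sum is unbounded. -/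
theorem exists_weight {F : ℤ → ℝ} (hF : ∀ i, 0 ≤ F i) (hs : Summable F) {η : ℝ} (hη : 0 < η) :
    ∃ w : ℕ → ℝ, (∀ k, 1 ≤ w k) ∧ (∀ k, |w (k + 1) - w k| ≤ η) ∧ Tendsto w atTop atTop ∧
      ∃ B : ℝ, ∀ s : Finset ℤ, ∑ i ∈ s, w i.natAbs * F i ≤ B := by
  let κ : ℕ → ℕ → ℝ := fun K k => min 1 (k / K)
  have hκ0 : ∀ K k, 0 ≤ κ K k := fun K k => le_min zero_le_one (by positivity)
  have hκ1 : ∀ K k, κ K k ≤ 1 := fun K k => min_le_left _ _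
  have hsum : ∀ K, Summable fun i : ℤ => κ K i.natAbs * F i := fun K =>
    hs.of_nonneg_of_le (fun i => mul_nonneg (hκ0 _ _) (hF i))
      fun i => mul_le_of_le_one_left (hF i) (hκ1 _ _)
  have hlim : Tendsto (fun K : ℕ => ∑' i : ℤ, κ K i.natAbs * F i) atTop (𝓝 (∑' _ : ℤ, (0 : ℝ))) := by
    refine tendsto_tsum_of_dominated_convergence hs (fun i => ?_) (Eventually.of_forall fun K i => ?_)
    · have h1 : Tendsto (fun K : ℕ => ((i.natAbs : ℝ) / K)) atTop (𝓝 0) :=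
        tendsto_const_div_atTop_nhds_zero_nat _
      have h2 := ((tendsto_const_nhds (x := (1 : ℝ))).min h1).mul_const (F i)
      simpa [κ] using h2
    · rw [Real.norm_of_nonneg (mul_nonneg (hκ0 _ _) (hF i))]
      exact mul_le_of_le_one_left (hF i) (hκ1 _ _)
  rw [tsum_zero] at hlim
  have hK : ∀ n : ℕ, ∃ K : ℕ, 0 < K ∧ (1 : ℝ) / K ≤ η / 2 / 2 ^ n ∧
      ∑' i : ℤ, κ K i.natAbs * F i ≤ 1 / 2 / 2 ^ n := by
    intro n
    have e1 := hlim.eventually_le_const (show (0 : ℝ) < 1 / 2 / 2 ^ n by positivity)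
    have e2 := tendsto_one_div_atTop_nhds_zero_nat (𝕜 := ℝ) |>.eventually_le_const
      (show (0 : ℝ) < η / 2 / 2 ^ n by positivity)
    obtain ⟨K, h⟩ := ((eventually_gt_atTop 0).and (e2.and e1)).exists
    exact ⟨K, h.1, h.2.1, h.2.2⟩
  choose K hK0 hKη hKF using hK
  have hgeo : ∀ c : ℝ, HasSum (fun n : ℕ => c / 2 / 2 ^ n) c := hasSum_geometric_two'
  have hws : ∀ k : ℕ, Summable fun n => κ (K n) k := fun k => by
    refine ((hgeo η).summable.mul_left (k : ℝ)).of_nonneg_of_le (fun n => hκ0 _ _) fun n => ?_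
    refine (min_le_right _ _).trans ?_
    rw [div_eq_mul_one_div]
    exact mul_le_mul_of_nonneg_left (hKη n) (Nat.cast_nonneg _)
  refine ⟨fun k => 1 + ∑' n, κ (K n) k, fun k => ?_, fun k => ?_, ?_, ∑' i, F i + 1, fun s => ?_⟩
  · have : 0 ≤ ∑' n, κ (K n) k := tsum_nonneg fun n => hκ0 (K n) k
    linarith
  · have hd : ∀ n, |κ (K n) (k + 1) - κ (K n) k| ≤ η / 2 / 2 ^ n := by
      intro n
      refine le_trans ?_ (hKη n)
      have hKp : (0 : ℝ) < K n := Nat.cast_pos.2 (hK0 n)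
      refine (abs_min_sub_min_le_max _ _ _ _).trans (max_le ?_ ?_)
      · simp
      · rw [← sub_div]; push_cast
        rw [add_sub_cancel_left, abs_of_nonneg (by positivity)]
    rw [add_sub_add_left_eq_sub, ← (hws (k + 1)).tsum_sub (hws k), ← Real.norm_eq_abs]
    exact tsum_of_norm_bounded (hgeo η) hd
  · rw [tendsto_atTop]
    intro b
    obtain ⟨M, hM⟩ := exists_nat_ge b
    filter_upwards [eventually_ge_atTop (∑ n ∈ Finset.range M, K n)] with k hk
    have h1 : ∑ n ∈ Finset.range M, κ (K n) k ≤ ∑' n, κ (K n) k :=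
      (hws k).sum_le_tsum _ fun n _ => hκ0 _ _
    have h2 : ∑ n ∈ Finset.range M, κ (K n) k = M := by
      rw [Finset.sum_congr rfl (g := fun _ => (1 : ℝ)), Finset.sum_const, Finset.card_range]
      · simp
      · intro n hn
        refine min_eq_left ?_
        rw [one_le_div (Nat.cast_pos.2 (hK0 n))]
        exact_mod_cast (Finset.single_le_sum (fun _ _ => Nat.zero_le _) hn).trans hk
    linarith
  · simp only [add_mul, one_mul, Finset.sum_add_distrib]
    refine add_le_add (hs.sum_le_tsum _ fun i _ => hF i) ?_
    simp only [← tsum_mul_right]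
    rw [← Summable.tsum_finsetSum fun i _ => (hws _).mul_right _]
    refine Real.tsum_le_of_sum_range_le (fun n => Finset.sum_nonneg fun i _ => mul_nonneg (hκ0 _ _) (hF i)) fun m => ?_
    refine le_trans (Finset.sum_le_sum fun n _ => ?_) ((hgeo 1).summable.sum_le_tsum _ fun n _ => by positivity) |>.trans_eq (hgeo 1).tsum_eq
    exact ((hsum (K n)).sum_le_tsum _ fun i _ => mul_nonneg (hκ0 _ _) (hF i)).trans (hKF n)

/-! ### Tail bounds from a Lyapunov function -/

/-- A tail bound for invariant laws of a scheme with a Lyapunov function. Nothing is assumed about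
the integrability of `Y`, hence the truncations. -/
theorem IsInvariantLaw.measure_le_of_lyapunov {S : Type} [MeasurableSpace S]
    {step : S → ℝ → S → Prop} {Δ : ℝ} {μ : ProbabilityMeasure S} (h : IsInvariantLaw step Δ μ)
    {Y : S → ℝ} {Z : S × ℝ → ℝ} {ρ C : ℝ} (hY : Measurable Y) (hY0 : ∀ x, 0 ≤ Y x)
    (hZ : Measurable Z) (hZ0 : ∀ x, 0 ≤ Z x) (hρ0 : 0 ≤ ρ) (hρ : ρ < 1) (hC : 0 ≤ C)
    (hstep : ∀ x s y, step x s y → Y y ≤ Z (x, s))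
    (hint : ∀ x, Integrable (fun s => Z (x, s)) (gaussianReal 0 Δ.toNNReal))
    (hle : ∀ x, ∫ s, Z (x, s) ∂(gaussianReal 0 Δ.toNNReal) ≤ ρ * Y x + C) {R : ℝ} (hR : 0 < R) :
    (μ : Measure S) {x | R ≤ Y x} ≤ ENNReal.ofReal (C / ((1 - ρ) * R)) := by
  obtain ⟨Ω, _, P, _, ψ₀, w, ψ₁, h0, hw, h1, e0, ew, hi, e1, hs⟩ := h
  set γ := gaussianReal 0 Δ.toNNReal
  rw [indepFun_iff_map_prod_eq_prod_map_map h0.aemeasurable hw.aemeasurable, e0, ew] at hi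
  have hbdd : ∀ {T : Type} [MeasurableSpace T] (ν : Measure T) [IsProbabilityMeasure ν]
      {G : T → ℝ} (M : ℝ), Measurable G → (∀ x, 0 ≤ G x) → 0 ≤ M →
      Integrable (fun x => min (G x) M) ν := by
    intro T _ ν _ G M hG hG0 hM
    refine Integrable.of_bound (hG.min measurable_const).aestronglyMeasurable M
      (Eventually.of_forall fun x => ?_)
    rw [Real.norm_of_nonneg (le_min (hG0 x) hM)]
    exact min_le_right _ _
  -- Truncation at `M` is monotone and concave, so the one-step inequality survives it: the average
  -- of `min Z M` is at most the truncated average of `Z`.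
  have hmain : ∀ M : ℝ, 0 ≤ M →
      ∫ x, min (Y x) M ∂(μ : Measure S) ≤ ∫ x, min (ρ * Y x + C) M ∂(μ : Measure S) := by
    intro M hM
    calc ∫ x, min (Y x) M ∂(μ : Measure S) = ∫ ω, min (Y (ψ₁ ω)) M ∂P := by
          rw [← e1, integral_map h1.aemeasurable (hY.min measurable_const).aestronglyMeasurable]
      _ ≤ ∫ ω, min (Z (ψ₀ ω, w ω)) M ∂P := by
          refine integral_mono_ae (hbdd P M (hY.comp h1) (fun _ => hY0 _) hM)
            (hbdd P M (hZ.comp (h0.prodMk hw)) (fun _ => hZ0 _) hM) ?_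
          filter_upwards [hs] with ω hω
          exact min_le_min_right _ (hstep _ _ _ hω)
      _ = ∫ z, min (Z z) M ∂((μ : Measure S).prod γ) := by
          rw [← hi, integral_map (h0.prodMk hw).aemeasurable
            (hZ.min measurable_const).aestronglyMeasurable]
      _ = ∫ x, ∫ s, min (Z (x, s)) M ∂γ ∂(μ : Measure S) :=
          integral_prod _ (hbdd _ M hZ hZ0 hM)
      _ ≤ ∫ x, min (ρ * Y x + C) M ∂(μ : Measure S) := by
          refine integral_mono (hbdd _ M hZ hZ0 hM).integral_prod_left
            (hbdd _ M ((hY.const_mul ρ).add_const C)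
              (fun x => add_nonneg (mul_nonneg hρ0 (hY0 x)) hC) hM) fun x => ?_
          have hb := hbdd γ M (hZ.comp (measurable_prodMk_left (x := x))) (fun _ => hZ0 _) hM
          refine le_min (le_trans (integral_mono hb (hint x) fun s => min_le_left _ _) (hle x)) ?_
          refine (integral_mono hb (integrable_const M) fun s => min_le_right _ _).trans_eq ?_
          simp
  have hρ' : 0 < (1 - ρ) * R := mul_pos (by linarith) hR
  have hband : ∀ n : ℕ, (μ : Measure S) {x | R ≤ Y x ∧ Y x ≤ n} ≤
      ENNReal.ofReal (C / ((1 - ρ) * R)) := by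
    intro n
    have hn : (0 : ℝ) ≤ n := Nat.cast_nonneg n
    have hms : MeasurableSet {x | R ≤ Y x ∧ Y x ≤ n} :=
      (measurableSet_le measurable_const hY).inter (measurableSet_le hY measurable_const)
    have i1 := hbdd (μ : Measure S) n hY hY0 hn
    have i2 := hbdd (μ : Measure S) n ((hY.const_mul ρ).add_const C)
      (fun x => add_nonneg (mul_nonneg hρ0 (hY0 x)) hC) hn
    -- The band avoids infinite integrals: where `Y ≤ n` the right side is at least `(1 - ρ) * Y`,
    -- and above `n` it is at least `C`. The difference of the minima has nonpositive integral by
    -- `hmain`.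
    have hpt : ∀ x, ({x | R ≤ Y x ∧ Y x ≤ n}.indicator (fun _ => (1 - ρ) * R) x)
        ≤ C + (min (Y x) n - min (ρ * Y x + C) n) := by
      intro x
      have hy := hY0 x
      by_cases hx : Y x ≤ n
      · rw [min_eq_left hx]
        have h3 := min_le_left (ρ * Y x + C) (n : ℝ)
        by_cases hx' : R ≤ Y x
        · rw [Set.indicator_of_mem (show x ∈ {x | R ≤ Y x ∧ Y x ≤ n} from ⟨hx', hx⟩)]
          nlinarith
        · rw [Set.indicator_of_notMem (fun h => hx' h.1)]
          nlinarith
      · rw [Set.indicator_of_notMem (fun h => hx h.2), min_eq_right (not_le.1 hx).le]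
        have h3 := min_le_right (ρ * Y x + C) (n : ℝ)
        linarith
    have h4 := integral_mono (μ := (μ : Measure S)) ((integrable_const _).indicator hms)
      ((integrable_const C).add (i1.sub i2)) hpt
    have h5 : ∫ x, (C + (min (Y x) n - min (ρ * Y x + C) n)) ∂(μ : Measure S) ≤ C := by
      have i3 : Integrable (fun x => min (Y x) n - min (ρ * Y x + C) n) (μ : Measure S) := i1.sub i2
      rw [integral_add (integrable_const C) i3, integral_sub i1 i2]
      have := hmain n hn
      simp; linarith
    rw [integral_indicator_const _ hms, smul_eq_mul] at h4
    have h6 := h4.trans h5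
    rw [← ENNReal.ofReal_toReal (measure_ne_top (μ : Measure S) _)]
    refine ENNReal.ofReal_le_ofReal ?_
    rw [le_div_iff₀ hρ']
    exact h6
  have hU : {x | R ≤ Y x} = ⋃ n : ℕ, {x | R ≤ Y x ∧ Y x ≤ n} := by
    ext x
    simp only [Set.mem_ofPred_eq, Set.mem_iUnion, exists_and_left]
    exact ⟨fun hx => ⟨hx, exists_nat_ge _⟩, fun hx => hx.1⟩
  have hmono : Monotone fun n : ℕ => {x | R ≤ Y x ∧ Y x ≤ n} := fun m n hmn x hx =>
    ⟨hx.1, hx.2.trans (Nat.cast_le.2 hmn)⟩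
  rw [hU, hmono.measure_iUnion]
  exact iSup_le hband

/-! ### The periodic Laplacian in a weighted product -/

/-- The cyclic shift moves `|i|` by at most one, even across the seam, where `N` and `-N` have the
same absolute value. A slowly varying even weight therefore varies slowly around the whole cycle. -/
theorem exists_rotation {N : ℕ} (hN : 1 ≤ N) :
    ∃ r : Equiv.Perm (sites N),
      (∀ (u : sites N → ℝ) (i : sites N),
        periodicLaplacian N u i = 2 * u i - u (r i) - u (r.symm i)) ∧
      ∀ i : sites N, (r i : ℤ).natAbs = (i : ℤ).natAbs ∨ (r i : ℤ).natAbs = (i : ℤ).natAbs + 1 ∨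
        (i : ℤ).natAbs = (r i : ℤ).natAbs + 1 := by
  have hmem : ∀ i : sites N, -(N : ℤ) ≤ i ∧ (i : ℤ) ≤ N := fun i => i.2
  let next : sites N → sites N := fun i =>
    if h : (i : ℤ) = N then ⟨-N, le_rfl, by omega⟩
    else ⟨i + 1, by have := hmem i; omega, by have := hmem i; omega⟩
  let prev : sites N → sites N := fun i =>
    if h : (i : ℤ) = -N then ⟨N, by omega, le_rfl⟩
    else ⟨i - 1, by have := hmem i; omega, by have := hmem i; omega⟩
  have hnext : ∀ i, (next i : ℤ) = if (i : ℤ) = N then -(N : ℤ) else i + 1 := fun i => by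
    simp only [next]; split_ifs <;> rfl
  have hprev : ∀ i, (prev i : ℤ) = if (i : ℤ) = -N then (N : ℤ) else i - 1 := fun i => by
    simp only [prev]; split_ifs <;> rfl
  have hz : ∀ (u : sites N → ℝ) (j : sites N) (k : ℤ), k = j → zeroExt u k = u j := by
    rintro u j k rfl
    exact dif_pos j.2
  refine ⟨⟨next, prev, fun i => Subtype.ext ?_, fun i => Subtype.ext ?_⟩, fun u i => ?_, fun i => ?_⟩
  · have := hmem i
    rw [hprev, hnext]; split_ifs <;> omega
  · have := hmem i
    rw [hnext, hprev]; split_ifs <;> omega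
  · have := hmem i
    change periodicLaplacian N u i = 2 * u i - u (next i) - u (prev i)
    unfold periodicLaplacian
    split_ifs with h1 h2
    · rw [hz u (prev i) _ (by rw [hprev]; split_ifs <;> omega), hz u i _ h1.symm,
        hz u (next i) _ (by rw [hnext]; split_ifs; rfl)]
      ring
    · rw [hz u (prev i) _ (by rw [hprev]; split_ifs; rfl), hz u i _ h2.symm,
        hz u (next i) _ (by rw [hnext]; split_ifs; omega)]
      ring
    · rw [hz u (prev i) _ (by rw [hprev]; split_ifs; rfl), hz u i _ rfl,
        hz u (next i) _ (by rw [hnext]; split_ifs; rfl)]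
      ring
  · have := hmem i
    change (next i : ℤ).natAbs = _ ∨ (next i : ℤ).natAbs = _ ∨ _ = (next i : ℤ).natAbs + 1
    rw [hnext]
    split_ifs <;> omega

/-- Young's inequality bounds the neighbour products by squares; moving the weight to the neighbour
costs `η`. After reindexing by the shift the main terms cancel, leaving only `η` times the
unweighted sum of squares, which is at most the weighted one since `w ≥ 1`. -/
theorem sum_weight_mul_periodicLaplacian_ge {N : ℕ} (hN : 1 ≤ N) {w : ℕ → ℝ} {η : ℝ} (hη : 0 ≤ η)
    (hw1 : ∀ k, 1 ≤ w k) (hw : ∀ k, |w (k + 1) - w k| ≤ η) (u : sites N → ℝ) :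
    -(η * ∑ i : sites N, w (i : ℤ).natAbs * u i ^ 2) ≤
      ∑ i : sites N, w (i : ℤ).natAbs * (u i * periodicLaplacian N u i) := by
  obtain ⟨r, hr, hadj⟩ := exists_rotation hN
  set κ : sites N → ℝ := fun i => w (i : ℤ).natAbs with hκ
  have hκ1 : ∀ i, 1 ≤ κ i := fun i => hw1 _
  have hκr : ∀ i, |κ (r i) - κ i| ≤ η := by
    intro i
    rcases hadj i with h | h | h
    · simpa [hκ, h] using hη
    · simp only [hκ, h]; exact hw _
    · simp only [hκ, h]; rw [abs_sub_comm]; exact hw _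
  have hκs : ∀ i, κ i ≤ κ (r.symm i) + η := fun i => by
    have := (abs_le.1 (hκr (r.symm i))).2
    rw [r.apply_symm_apply] at this; linarith
  have hpt : ∀ i, κ i * u i ^ 2 - (1 / 2 * (κ (r i) + η) * u (r i) ^ 2)
      - (1 / 2 * (κ (r.symm i) + η) * u (r.symm i) ^ 2) ≤ κ i * (u i * periodicLaplacian N u i) := by
    intro i
    rw [hr]
    have h1 := (abs_le.1 (hκr i)).1
    have h2 := hκs i
    have h0 := hκ1 i
    nlinarith [mul_nonneg (zero_le_one.trans h0) (sq_nonneg (u i - u (r i))),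
      mul_nonneg (zero_le_one.trans h0) (sq_nonneg (u i - u (r.symm i))),
      mul_nonneg (sub_nonneg.2 h2) (sq_nonneg (u (r.symm i))),
      mul_nonneg (show 0 ≤ κ (r i) + η - κ i by linarith) (sq_nonneg (u (r i)))]
  have hsum := Finset.sum_le_sum fun i (_ : i ∈ Finset.univ) => hpt i
  rw [Finset.sum_sub_distrib, Finset.sum_sub_distrib,
    Equiv.sum_comp r fun j => 1 / 2 * (κ j + η) * u j ^ 2,
    Equiv.sum_comp r.symm fun j => 1 / 2 * (κ j + η) * u j ^ 2] at hsum
  refine le_trans ?_ hsum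
  rw [← Finset.sum_sub_distrib, ← Finset.sum_sub_distrib, Finset.mul_sum, ← Finset.sum_neg_distrib]
  refine Finset.sum_le_sum fun i _ => ?_
  have := mul_nonneg (mul_nonneg hη (sub_nonneg.2 (hκ1 i))) (sq_nonneg (u i))
  nlinarith

/-! ### One-step energy and moment estimates -/

/-- The one-site energy inequality: the reaction terms cancel up to a square. -/
theorem site_energy_le {b₁ b₂ a₁ a₂ d₁ d₂ Δ x y U V Ax Ay : ℝ} {p : ℕ} (hb₁ : 0 < b₁)
    (hb₂ : 0 < b₂) (hΔ : 0 < Δ)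
    (hx : x = U - d₁ * Ax * Δ - a₁ * x * Δ + (b₁ * (x ^ (2 * p) * y) - b₂ * x ^ (2 * p + 1)) * Δ)
    (hy : y = V - d₂ * Ay * Δ - a₂ * y * Δ - (b₁ * (x ^ (2 * p) * y) - b₂ * x ^ (2 * p + 1)) * Δ) :
    b₂ * (1 + 2 * a₁ * Δ) * x ^ 2 + b₁ * (1 + 2 * a₂ * Δ) * y ^ 2
      + 2 * Δ * (b₂ * d₁ * (x * Ax) + b₁ * d₂ * (y * Ay)) ≤ b₂ * U ^ 2 + b₁ * V ^ 2 := by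
  have hq : 0 ≤ x ^ (2 * p) := by rw [pow_mul]; positivity
  rw [pow_succ] at hx hy
  set q := x ^ (2 * p)
  have hU : U = x + d₁ * Ax * Δ + a₁ * x * Δ - (b₁ * (q * y) - b₂ * (q * x)) * Δ := by linarith
  have hV : V = y + d₂ * Ay * Δ + a₂ * y * Δ + (b₁ * (q * y) - b₂ * (q * x)) * Δ := by linarith
  have h1 : 2 * x * U ≤ x ^ 2 + U ^ 2 := by nlinarith [sq_nonneg (x - U)]
  have h2 : 2 * y * V ≤ y ^ 2 + V ^ 2 := by nlinarith [sq_nonneg (y - V)]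
  -- Pairing the equations with `b₂ * x` and `b₁ * y` leaves exactly this term from the reaction; it
  -- is nonnegative because the exponent `2 * p` is even.
  have h3 : 0 ≤ 2 * Δ * (q * (b₁ * y - b₂ * x) ^ 2) := by positivity
  have e : b₂ * (2 * x * U) + b₁ * (2 * y * V) = 2 * b₂ * x ^ 2 + 2 * b₁ * y ^ 2
      + 2 * a₁ * Δ * b₂ * x ^ 2 + 2 * a₂ * Δ * b₁ * y ^ 2
      + 2 * Δ * (b₂ * d₁ * (x * Ax) + b₁ * d₂ * (y * Ay))
      + 2 * Δ * (q * (b₁ * y - b₂ * x) ^ 2) := by rw [hU, hV]; ring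
  nlinarith [mul_le_mul_of_nonneg_left h1 hb₂.le, mul_le_mul_of_nonneg_left h2 hb₁.le]

/-- The weighted energy on the sites `ι`. -/
def SelkovData.energy (D : SelkovData) {ι : Type} [Fintype ι] (κ : ι → ℝ) (u v : ι → ℝ) : ℝ :=
  ∑ i, κ i * (D.b₂ * u i ^ 2 + D.b₁ * v i ^ 2)

/-- The first component of the explicit part of the scheme. -/
def SelkovData.explicit₁ (D : SelkovData) {ι : Type} (e : ι → ℤ) (Δ : ℝ) (u : ι → ℝ) (w : ℝ)
    (i : ι) : ℝ :=
  (u i + D.f (e i) * Δ) + (D.h (e i) + D.σ (e i) (u i)) * w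

/-- The second component of the explicit part of the scheme. -/
def SelkovData.explicit₂ (D : SelkovData) {ι : Type} (e : ι → ℤ) (Δ : ℝ) (v : ι → ℝ) (w : ℝ)
    (i : ι) : ℝ :=
  (v i + D.g (e i) * Δ) + (D.h (e i) + D.σ (e i) (v i)) * w

theorem SelkovData.energy_nonneg (D : SelkovData) (hb₁ : 0 < D.b₁) (hb₂ : 0 < D.b₂) {ι : Type}
    [Fintype ι] {κ : ι → ℝ} (hκ : ∀ i, 0 ≤ κ i) (u v : ι → ℝ) : 0 ≤ D.energy κ u v :=
  Finset.sum_nonneg fun i _ => mul_nonneg (hκ i) (by positivity)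

/-- Of the damping `2 * a` available in each component, the defect of positivity of the Laplacian
uses at most `a`; the other `a` gives the factor on the left. -/
theorem SelkovData.BEMStepOn.energy_le {D : SelkovData} {ι : Type} [Fintype ι] {e : ι → ℤ}
    {A : (ι → ℝ) → ι → ℝ} {Δ w : ℝ} {u v u' v' : ι → ℝ} (h : D.BEMStepOn e A Δ u v w u' v')
    (hd₁ : 0 < D.d₁) (hd₂ : 0 < D.d₂) (hb₁ : 0 < D.b₁) (hb₂ : 0 < D.b₂) (hΔ : 0 < Δ)
    {κ : ι → ℝ} (hκ : ∀ i, 0 ≤ κ i) {η a : ℝ}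
    (hη₁ : 2 * (η * D.d₁) ≤ a) (hη₂ : 2 * (η * D.d₂) ≤ a) (ha₁ : a ≤ D.a₁) (ha₂ : a ≤ D.a₂)
    (hA : ∀ x : ι → ℝ, -(η * ∑ i, κ i * x i ^ 2) ≤ ∑ i, κ i * (x i * A x i)) :
    (1 + a * Δ) * D.energy κ u' v' ≤
      D.energy κ (D.explicit₁ e Δ u w) (D.explicit₂ e Δ v w) := by
  have hsite : ∀ i, κ i * (D.b₂ * (1 + 2 * D.a₁ * Δ) * u' i ^ 2
      + D.b₁ * (1 + 2 * D.a₂ * Δ) * v' i ^ 2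
      + 2 * Δ * (D.b₂ * D.d₁ * (u' i * A u' i) + D.b₁ * D.d₂ * (v' i * A v' i)))
      ≤ κ i * (D.b₂ * D.explicit₁ e Δ u w i ^ 2 + D.b₁ * D.explicit₂ e Δ v w i ^ 2) := by
    intro i
    refine mul_le_mul_of_nonneg_left (site_energy_le (p := D.p) hb₁ hb₂ hΔ ?_ ?_) (hκ i)
    · rw [SelkovData.explicit₁]; linarith [h.1 i]
    · rw [SelkovData.explicit₂]; linarith [h.2 i]
  have hsum := Finset.sum_le_sum fun i (_ : i ∈ Finset.univ) => hsite i
  refine le_trans ?_ hsum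
  set X := ∑ i, κ i * u' i ^ 2 with hX
  set Y := ∑ i, κ i * v' i ^ 2 with hY
  have hX0 : 0 ≤ X := Finset.sum_nonneg fun i _ => mul_nonneg (hκ i) (sq_nonneg _)
  have hY0 : 0 ≤ Y := Finset.sum_nonneg fun i _ => mul_nonneg (hκ i) (sq_nonneg _)
  have e1 : D.energy κ u' v' = D.b₂ * X + D.b₁ * Y := by
    rw [SelkovData.energy, hX, hY, Finset.mul_sum, Finset.mul_sum, ← Finset.sum_add_distrib]
    exact Finset.sum_congr rfl fun i _ => by ring
  have e2 : ∑ i, κ i * (D.b₂ * (1 + 2 * D.a₁ * Δ) * u' i ^ 2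
      + D.b₁ * (1 + 2 * D.a₂ * Δ) * v' i ^ 2
      + 2 * Δ * (D.b₂ * D.d₁ * (u' i * A u' i) + D.b₁ * D.d₂ * (v' i * A v' i)))
      = D.b₂ * (1 + 2 * D.a₁ * Δ) * X + D.b₁ * (1 + 2 * D.a₂ * Δ) * Y
        + 2 * Δ * (D.b₂ * D.d₁ * ∑ i, κ i * (u' i * A u' i)
          + D.b₁ * D.d₂ * ∑ i, κ i * (v' i * A v' i)) := by
    simp only [hX, hY, Finset.mul_sum, ← Finset.sum_add_distrib]
    exact Finset.sum_congr rfl fun i _ => by ring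
  rw [e1, e2]
  have h1 := mul_le_mul_of_nonneg_left (hA u') (show 0 ≤ 2 * Δ * (D.b₂ * D.d₁) by positivity)
  have h2 := mul_le_mul_of_nonneg_left (hA v') (show 0 ≤ 2 * Δ * (D.b₁ * D.d₂) by positivity)
  rw [← hX] at h1
  rw [← hY] at h2
  have c1 : 0 ≤ (2 * D.a₁ - 2 * (η * D.d₁) - a) * (Δ * D.b₂ * X) :=
    mul_nonneg (by linarith) (by positivity)
  have c2 : 0 ≤ (2 * D.a₂ - 2 * (η * D.d₂) - a) * (Δ * D.b₁ * Y) :=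
    mul_nonneg (by linarith) (by positivity)
  nlinarith

theorem integral_sq_gaussianReal {Δ : ℝ} (hΔ : 0 ≤ Δ) (A B : ℝ) :
    Integrable (fun s => (A + B * s) ^ 2) (gaussianReal 0 Δ.toNNReal) ∧
      ∫ s, (A + B * s) ^ 2 ∂(gaussianReal 0 Δ.toNNReal) = A ^ 2 + Δ * B ^ 2 := by
  have h2 : MemLp id 2 (gaussianReal 0 Δ.toNNReal) := memLp_id_gaussianReal 2
  have i2 : Integrable (fun s : ℝ => s ^ 2) (gaussianReal 0 Δ.toNNReal) := h2.integrable_sq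
  have i1 : Integrable (fun s : ℝ => s) (gaussianReal 0 Δ.toNNReal) := h2.integrable (by norm_num)
  have e1 : ∫ s, s ∂(gaussianReal 0 Δ.toNNReal) = 0 := integral_id_gaussianReal
  have e2 : ∫ s, s ^ 2 ∂(gaussianReal 0 Δ.toNNReal) = Δ := by
    have := variance_fun_id_gaussianReal (μ := 0) (v := Δ.toNNReal)
    rw [variance_eq_integral aemeasurable_id', e1] at this
    simpa [hΔ] using this
  have e : (fun s : ℝ => (A + B * s) ^ 2) = fun s => (A ^ 2 + 2 * A * B * s) + B ^ 2 * s ^ 2 := by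
    ext s; ring
  have i3 : Integrable (fun s : ℝ => A ^ 2 + 2 * A * B * s) (gaussianReal 0 Δ.toNNReal) :=
    (integrable_const _).add (i1.const_mul _)
  rw [e]
  refine ⟨i3.add (i2.const_mul _), ?_⟩
  rw [integral_add i3 (i2.const_mul _), integral_add (integrable_const _) (i1.const_mul _),
    integral_const_mul, integral_const_mul, e1, e2]
  simp; ring

/-- The left side is the mean square of the explicit part. Noise growth contributes `2 * β ^ 2 ≤ a /
8` and the cross term with the force another `a / 8`, so the explicit step expands at rate `a / 4`,
below the implicit damping rate `a`. -/
theorem site_moment_le {a Δ β u f h δ s : ℝ} (ha : 0 < a) (hΔ : 0 < Δ) (hβ : 16 * β ^ 2 ≤ a)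
    (hs : |s| ≤ δ + β * |u|) :
    (u + f * Δ) ^ 2 + Δ * (h + s) ^ 2 ≤
      (1 + a / 4 * Δ) * u ^ 2 + (Δ ^ 2 + 8 * Δ / a + 4 * Δ) * (f ^ 2 + h ^ 2 + δ ^ 2) := by
  have h1 : (h + s) ^ 2 ≤ 4 * (h ^ 2 + δ ^ 2) + 2 * β ^ 2 * u ^ 2 := by
    have e1 : |h + s| ≤ |h| + δ + β * |u| := (abs_add_le h s).trans (by linarith)
    have e2 : (h + s) ^ 2 ≤ (|h| + δ + β * |u|) ^ 2 := by
      rw [← sq_abs (h + s)]; exact pow_le_pow_left₀ (abs_nonneg _) e1 2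
    have e3 : β ^ 2 * |u| ^ 2 = β ^ 2 * u ^ 2 := by rw [sq_abs]
    nlinarith [sq_nonneg (|h| + δ - β * |u|), sq_nonneg (|h| - δ), sq_abs h]
  have h2 : 2 * (u * f) ≤ a / 8 * u ^ 2 + 8 / a * f ^ 2 := by
    have e : a / 8 * u ^ 2 + 8 / a * f ^ 2 - 2 * (u * f) = a / 8 * (u - 8 / a * f) ^ 2 := by
      field_simp; ring
    have : 0 ≤ a / 8 * (u - 8 / a * f) ^ 2 := by positivity
    linarith
  have h3 : 8 * Δ / a = Δ * (8 / a) := by ring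
  rw [h3]
  have h4 : 0 ≤ 8 / a := by positivity
  have h5 : (u + f * Δ) ^ 2 = u ^ 2 + Δ * (2 * (u * f)) + Δ ^ 2 * f ^ 2 := by ring
  have h6 := mul_le_mul_of_nonneg_left h1 hΔ.le
  have h7 := mul_le_mul_of_nonneg_left h2 hΔ.le
  have h8 : Δ * (2 * β ^ 2 * u ^ 2) ≤ Δ * (a / 8 * u ^ 2) :=
    mul_le_mul_of_nonneg_left (mul_le_mul_of_nonneg_right (by linarith) (sq_nonneg u)) hΔ.le
  have h9 : 0 ≤ (Δ ^ 2 + Δ * (8 / a)) * (h ^ 2 + δ ^ 2) + 4 * Δ * f ^ 2 := by positivity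
  rw [h5]
  nlinarith

theorem SelkovData.integral_energy_explicit (D : SelkovData) {ι : Type} [Fintype ι] (e : ι → ℤ)
    {Δ a β : ℝ} {δ : ℤ → ℝ} (κ : ι → ℝ) (hκ : ∀ i, 0 ≤ κ i) (u v : ι → ℝ)
    (hb₁ : 0 < D.b₁) (hb₂ : 0 < D.b₂) (ha : 0 < a) (hΔ : 0 < Δ) (hβ : 16 * β ^ 2 ≤ a)
    (hgrowth : ∀ (i : ℤ) (s : ℝ), |D.σ i s| ≤ δ i + β * |s|) :
    Integrable (fun s => D.energy κ (D.explicit₁ e Δ u s) (D.explicit₂ e Δ v s))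
        (gaussianReal 0 Δ.toNNReal) ∧
      ∫ s, D.energy κ (D.explicit₁ e Δ u s) (D.explicit₂ e Δ v s) ∂(gaussianReal 0 Δ.toNNReal) ≤
        (1 + a / 4 * Δ) * D.energy κ u v + (Δ ^ 2 + 8 * Δ / a + 4 * Δ) *
          ∑ i, κ i * (D.b₂ * (D.f (e i) ^ 2 + D.h (e i) ^ 2 + δ (e i) ^ 2)
            + D.b₁ * (D.g (e i) ^ 2 + D.h (e i) ^ 2 + δ (e i) ^ 2)) := by
  have hi : ∀ i ∈ (Finset.univ : Finset ι), Integrable (fun s => κ i *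
      (D.b₂ * D.explicit₁ e Δ u s i ^ 2 + D.b₁ * D.explicit₂ e Δ v s i ^ 2))
      (gaussianReal 0 Δ.toNNReal) := fun i _ =>
    (((integral_sq_gaussianReal hΔ.le _ _).1.const_mul _).add
      ((integral_sq_gaussianReal hΔ.le _ _).1.const_mul _)).const_mul _
  unfold SelkovData.energy
  refine ⟨integrable_finsetSum _ hi, ?_⟩
  rw [integral_finsetSum _ hi, Finset.mul_sum, Finset.mul_sum, ← Finset.sum_add_distrib]
  refine Finset.sum_le_sum fun i _ => ?_
  unfold SelkovData.explicit₁ SelkovData.explicit₂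
  rw [integral_const_mul, integral_add ((integral_sq_gaussianReal hΔ.le _ _).1.const_mul _)
      ((integral_sq_gaussianReal hΔ.le _ _).1.const_mul _), integral_const_mul, integral_const_mul,
    (integral_sq_gaussianReal hΔ.le _ _).2, (integral_sq_gaussianReal hΔ.le _ _).2]
  have h1 := site_moment_le (f := D.f (e i)) (h := D.h (e i)) ha hΔ hβ (hgrowth (e i) (u i))
  have h2 := site_moment_le (f := D.g (e i)) (h := D.h (e i)) ha hΔ hβ (hgrowth (e i) (v i))
  have h3 := mul_le_mul_of_nonneg_left (add_le_add (mul_le_mul_of_nonneg_left h1 hb₂.le)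
    (mul_le_mul_of_nonneg_left h2 hb₁.le)) (hκ i)
  refine h3.trans_eq ?_
  ring

/-! ### Uniform tails and tightness -/

/-- The invariant measures of the truncations satisfy a weighted tail bound, uniformly in `N`. -/
theorem SelkovData.exists_uniform_tail_bound (D : SelkovData)
    (hd₁ : 0 < D.d₁) (hd₂ : 0 < D.d₂) (ha₁ : 0 < D.a₁) (ha₂ : 0 < D.a₂)
    (hb₁ : 0 < D.b₁) (hb₂ : 0 < D.b₂) {L β : ℝ} {δ : Ell2}
    (hLip : ∀ (i : ℤ) (s₁ s₂ : ℝ), |D.σ i s₁ - D.σ i s₂| ≤ L * |s₁ - s₂|)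
    (hgrowth : ∀ (i : ℤ) (s : ℝ), |D.σ i s| ≤ δ i + β * |s|)
    (hdiss : 16 * β ^ 2 < min D.a₁ D.a₂) {Δ : ℝ} (hΔ : 0 < Δ) :
    ∃ w : ℕ → ℝ, (∀ k, 1 ≤ w k) ∧ Tendsto w atTop atTop ∧ ∃ C : ℝ, 0 ≤ C ∧
      ∀ N : ℕ, 1 ≤ N → ∀ ν : ProbabilityMeasure (FinState N),
        IsInvariantLaw (D.BEMStepTrunc N Δ) Δ ν → ∀ R : ℝ, 0 < R →
          (ν : Measure (FinState N))
            {x | R ≤ D.energy (fun i : sites N => w (i : ℤ).natAbs) x.1 x.2}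
            ≤ ENNReal.ofReal (C / R) := by
  set a := min D.a₁ D.a₂ with ha_def
  have ha : 0 < a := lt_min ha₁ ha₂
  set d := max D.d₁ D.d₂
  have hd : 0 < d := lt_max_of_lt_left hd₁
  -- The largest slope of the weight for which the Laplacian costs at most `a` for both diffusion
  -- coefficients.
  have hη : 0 < a / (2 * d) := by positivity
  have hηd : ∀ c, c ≤ d → 2 * (a / (2 * d) * c) ≤ a := fun c hc => by
    calc 2 * (a / (2 * d) * c) ≤ 2 * (a / (2 * d) * d) := by gcongr
      _ = a := by field_simp
  have hσ : ∀ i, Measurable (D.σ i) := fun i =>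
    (LipschitzWith.of_dist_le' (K := L) fun x y => by
      rw [Real.dist_eq, Real.dist_eq]; exact hLip i x y).continuous.measurable
  let F : ℤ → ℝ := fun i => D.b₂ * (D.f i ^ 2 + D.h i ^ 2 + δ i ^ 2)
            + D.b₁ * (D.g i ^ 2 + D.h i ^ 2 + δ i ^ 2)
  have hF0 : ∀ i, 0 ≤ F i := fun i => by positivity
  have hFs : Summable F :=
    (((D.f.summable_sq.add D.h.summable_sq).add δ.summable_sq).mul_left _).add
      (((D.g.summable_sq.add D.h.summable_sq).add δ.summable_sq).mul_left _)
  obtain ⟨w, hw1, hwη, hwt, B, hB⟩ := exists_weight hF0 hFs hη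
  have hB0 : 0 ≤ B := by simpa using hB ∅
  have hw0 : ∀ k, 0 ≤ w k := fun k => zero_le_one.trans (hw1 k)
  have hpos : 0 < 1 + a * Δ := by positivity
  set K := Δ ^ 2 + 8 * Δ / a + 4 * Δ
  have hK : 0 ≤ K := by positivity
  -- The contraction ratio, expansion over implicit damping, is below one for every positive `Δ`.
  have hρ : (1 + a / 4 * Δ) / (1 + a * Δ) < 1 := by
    rw [div_lt_one hpos]; nlinarith [mul_pos ha hΔ]
  refine ⟨w, hw1, hwt, K * B / (1 + a * Δ) / (1 - (1 + a / 4 * Δ) / (1 + a * Δ)),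
    div_nonneg (by positivity) (by linarith), fun N hN ν hν R hR => ?_⟩
  rw [div_div]
  have hmomN := fun x : FinState N => D.integral_energy_explicit (fun i : sites N => (i : ℤ))
    (δ := δ) (fun i : sites N => w (i : ℤ).natAbs) (fun i => hw0 _) x.1 x.2 hb₁ hb₂ ha hΔ
    hdiss.le hgrowth
  refine hν.measure_le_of_lyapunov (Z := fun z => D.energy (fun i : sites N => w (i : ℤ).natAbs)
    (D.explicit₁ (fun i : sites N => (i : ℤ)) Δ z.1.1 z.2)
    (D.explicit₂ (fun i : sites N => (i : ℤ)) Δ z.1.2 z.2) / (1 + a * Δ))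
    ?_ (fun x => D.energy_nonneg hb₁ hb₂ (fun i => hw0 _) _ _) ?_
    (fun z => div_nonneg (D.energy_nonneg hb₁ hb₂ (fun i => hw0 _) _ _) hpos.le)
    (by positivity) hρ (by positivity) (fun x s y hxy => ?_) (fun x => ?_) (fun x => ?_) hR
  · unfold SelkovData.energy
    fun_prop
  · unfold SelkovData.energy SelkovData.explicit₁ SelkovData.explicit₂
    have h1 : ∀ i : sites N, Measurable fun z : FinState N × ℝ => D.σ i (z.1.1 i) :=
      fun i => (hσ i).comp (by fun_prop)
    have h2 : ∀ i : sites N, Measurable fun z : FinState N × ℝ => D.σ i (z.1.2 i) :=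
      fun i => (hσ i).comp (by fun_prop)
    fun_prop
  · rw [le_div_iff₀' hpos]
    exact SelkovData.BEMStepOn.energy_le hxy hd₁ hd₂ hb₁ hb₂ hΔ (fun i => hw0 _)
      (hηd _ (le_max_left _ _)) (hηd _ (le_max_right _ _)) (min_le_left _ _) (min_le_right _ _)
      fun u => sum_weight_mul_periodicLaplacian_ge hN hη.le hw1 hwη u
  · exact (hmomN x).1.div_const _
  · rw [integral_div, div_mul_eq_mul_div, ← add_div]
    refine div_le_div_of_nonneg_right ((hmomN x).2.trans ?_) hpos.le
    refine add_le_add_right (mul_le_mul_of_nonneg_left ?_ hK) _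
    -- The sites form a finite subset of `ℤ`, so the weighted forcing is at most `B` for every `N`:
    -- the source of uniformity.
    have := hB (Finset.univ.map (Function.Embedding.subtype fun i : ℤ => i ∈ sites N))
    rw [Finset.sum_map] at this
    exact this

theorem continuous_embed (N : ℕ) : Continuous (embed N) := by
  let T : (sites N → ℝ) →ₗ[ℝ] Ell2 :=
    { toFun := fun u => ⟨zeroExt u, zeroExt_mem u⟩
      map_add' := fun u v => lp.ext (funext fun i => by
        change zeroExt (u + v) i = zeroExt u i + zeroExt v i
        unfold zeroExt; split_ifs <;> simp)
      map_smul' := fun c u => lp.ext (funext fun i => by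
        change zeroExt (c • u) i = c * zeroExt u i
        unfold zeroExt; split_ifs <;> simp) }
  have hT : Continuous T := T.continuous_of_finiteDimensional
  exact (hT.comp continuous_fst).prodMk (hT.comp continuous_snd)

theorem sum_zeroExt_sq_le {N : ℕ} {κ : ℤ → ℝ} (hκ : ∀ i, 0 ≤ κ i) (u : sites N → ℝ)
    (s : Finset ℤ) : ∑ i ∈ s, κ i * zeroExt u i ^ 2 ≤ ∑ i : sites N, κ i * u i ^ 2 := by
  have h1 : ∑ i : sites N, κ i * u i ^ 2
      = ∑ i ∈ Finset.univ.map (Function.Embedding.subtype fun i : ℤ => i ∈ sites N),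
        κ i * zeroExt u i ^ 2 := by
    rw [Finset.sum_map]
    refine Finset.sum_congr rfl fun i _ => ?_
    change _ = κ i * zeroExt u i ^ 2
    rw [show zeroExt u i = u i from dif_pos i.2]
  rw [h1, ← Finset.sum_filter_ne_zero s]
  refine Finset.sum_le_sum_of_subset_of_nonneg (fun i hi => ?_)
    fun i _ _ => mul_nonneg (hκ i) (sq_nonneg _)
  replace hi := (Finset.mem_filter.1 hi).2
  have : i ∈ sites N := by
    by_contra hc
    exact hi (by rw [show zeroExt u i = 0 from dif_neg hc]; simp)
  simp only [Finset.mem_map, Finset.mem_univ, true_and]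
  exact ⟨⟨i, this⟩, rfl⟩

/-- The invariant measures of all the truncations together form a tight set. -/
theorem SelkovData.isTight_truncInvMeasures (D : SelkovData)
    (hd₁ : 0 < D.d₁) (hd₂ : 0 < D.d₂) (ha₁ : 0 < D.a₁) (ha₂ : 0 < D.a₂)
    (hb₁ : 0 < D.b₁) (hb₂ : 0 < D.b₂) {L β : ℝ} {δ : Ell2}
    (hLip : ∀ (i : ℤ) (s₁ s₂ : ℝ), |D.σ i s₁ - D.σ i s₂| ≤ L * |s₁ - s₂|)
    (hgrowth : ∀ (i : ℤ) (s : ℝ), |D.σ i s| ≤ δ i + β * |s|)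
    (hdiss : 16 * β ^ 2 < min D.a₁ D.a₂) {Δ : ℝ} (hΔ : 0 < Δ) :
    IsTightMeasureSet {m : Measure PhaseSpace | ∃ N : ℕ, 1 ≤ N ∧
      ∃ μ ∈ D.truncInvMeasures Δ N, m = (μ : Measure PhaseSpace)} := by
  obtain ⟨w, hw1, hwt, C, hC, hbound⟩ := D.exists_uniform_tail_bound hd₁ hd₂ ha₁ ha₂ hb₁ hb₂ hLip
    hgrowth hdiss hΔ
  have hw0 : ∀ k, 0 ≤ w k := fun k => zero_le_one.trans (hw1 k)
  rw [isTightMeasureSet_iff_exists_isCompact_measure_compl_le]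
  intro ε hε
  obtain ⟨R, hR, hRε⟩ : ∃ R : ℝ, 0 < R ∧ ENNReal.ofReal (C / R) ≤ ε := by
    have h1 : Tendsto (fun R : ℝ => ENNReal.ofReal (C / R)) atTop (𝓝 0) := by
      rw [← ENNReal.ofReal_zero]
      exact ENNReal.tendsto_ofReal (tendsto_const_nhds.div_atTop tendsto_id)
    obtain ⟨R, h⟩ := ((eventually_gt_atTop 0).and (h1.eventually_le_const hε)).exists
    exact ⟨R, h.1, h.2⟩
  set K₁ := {x : Ell2 | ∀ s : Finset ℤ, ∑ i ∈ s, w i.natAbs * x i ^ 2 ≤ R / D.b₂}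
  set K₂ := {x : Ell2 | ∀ s : Finset ℤ, ∑ i ∈ s, w i.natAbs * x i ^ 2 ≤ R / D.b₁}
  have hK : IsCompact (K₁ ×ˢ K₂) :=
    (isCompact_weightedEllipsoid hw1 hwt _).prod (isCompact_weightedEllipsoid hw1 hwt _)
  refine ⟨K₁ ×ˢ K₂, hK, ?_⟩
  rintro _ ⟨N, hN, μ, ⟨ν, hν, hμ⟩, rfl⟩
  rw [hμ, Measure.map_apply (continuous_embed N).measurable hK.measurableSet.compl]
  refine (measure_mono fun x hx => ?_).trans ((hbound N hN ν hν R hR).trans hRε)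
  rw [Set.mem_ofPred_eq]
  by_contra hlt
  rw [not_le] at hlt
  have hsplit : D.energy (fun i : sites N => w (i : ℤ).natAbs) x.1 x.2
      = D.b₂ * ∑ i : sites N, w (i : ℤ).natAbs * x.1 i ^ 2
        + D.b₁ * ∑ i : sites N, w (i : ℤ).natAbs * x.2 i ^ 2 := by
    rw [SelkovData.energy, Finset.mul_sum, Finset.mul_sum, ← Finset.sum_add_distrib]
    exact Finset.sum_congr rfl fun i _ => by ring
  have h0 : ∀ u : sites N → ℝ, 0 ≤ ∑ i : sites N, w (i : ℤ).natAbs * u i ^ 2 := fun u =>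
    Finset.sum_nonneg fun i _ => mul_nonneg (hw0 _) (sq_nonneg _)
  have e1 := mul_nonneg hb₂.le (h0 x.1)
  have e2 := mul_nonneg hb₁.le (h0 x.2)
  refine hx ⟨fun s => ?_, fun s => ?_⟩
  · refine (sum_zeroExt_sq_le (κ := fun i => w i.natAbs) (fun i => hw0 _) x.1 s).trans ?_
    rw [le_div_iff₀' hb₂]; linarith
  · refine (sum_zeroExt_sq_le (κ := fun i => w i.natAbs) (fun i => hw0 _) x.2 s).trans ?_
    rw [le_div_iff₀' hb₁]; linarith

/-! ### Passage to the limit in the joint laws -/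

/-- The defect of the first equation of the scheme at the site `i`. -/
def SelkovData.defect₁ (D : SelkovData) (Δ : ℝ) (i : ℤ) (x : PhaseSpace) (w : ℝ) (y : PhaseSpace) :
    ℝ :=
  y.1 i - (x.1 i - D.d₁ * laplacian y.1 i * Δ - D.a₁ * y.1 i * Δ
      + D.b₁ * (y.1 i ^ (2 * D.p) * y.2 i) * Δ - D.b₂ * y.1 i ^ (2 * D.p + 1) * Δ
      + D.f i * Δ + (D.h i + D.σ i (x.1 i)) * w)

/-- The defect of the second equation of the scheme at the site `i`. -/
def SelkovData.defect₂ (D : SelkovData) (Δ : ℝ) (i : ℤ) (x : PhaseSpace) (w : ℝ) (y : PhaseSpace) :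
    ℝ :=
  y.2 i - (x.2 i - D.d₂ * laplacian y.2 i * Δ - D.a₂ * y.2 i * Δ
      - D.b₁ * (y.1 i ^ (2 * D.p) * y.2 i) * Δ + D.b₂ * y.1 i ^ (2 * D.p + 1) * Δ
      + D.g i * Δ + (D.h i + D.σ i (x.2 i)) * w)

theorem SelkovData.bemStep_iff_defect (D : SelkovData) {Δ : ℝ} {x y : PhaseSpace} {w : ℝ} :
    D.BEMStep Δ x w y ↔ (∀ i, D.defect₁ Δ i x w y = 0) ∧ ∀ i, D.defect₂ Δ i x w y = 0 := by
  unfold SelkovData.defect₁ SelkovData.defect₂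
  simp only [sub_eq_zero]
  rfl

theorem periodicLaplacian_eq_laplacian {N : ℕ} (u : sites N → ℝ) (i : sites N)
    (hi : (i : ℤ).natAbs < N) : periodicLaplacian N u i = laplacian (zeroExt u) i := by
  unfold periodicLaplacian laplacian
  rw [if_neg (by omega), if_neg (by omega)]

/-- Strictly inside the window the periodic wrap-around is invisible, so the zero extension solves
the full-lattice equation there. The endpoints `±N` are excluded. -/
theorem SelkovData.BEMStepTrunc.defect_eq_zero {D : SelkovData} {N : ℕ} {Δ w : ℝ}
    {x y : FinState N} (h : D.BEMStepTrunc N Δ x w y) {i : ℤ} (hi : i.natAbs < N) :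
    D.defect₁ Δ i (embed N x) w (embed N y) = 0 ∧
      D.defect₂ Δ i (embed N x) w (embed N y) = 0 := by
  have hmem : i ∈ sites N := ⟨by omega, by omega⟩
  have h1 := h.1 ⟨i, hmem⟩
  have h2 := h.2 ⟨i, hmem⟩
  rw [periodicLaplacian_eq_laplacian _ _ hi] at h1 h2
  have hz : ∀ u : sites N → ℝ, zeroExt u i = u ⟨i, hmem⟩ := fun u => dif_pos hmem
  simp only [← hz] at h1 h2
  exact ⟨sub_eq_zero.2 h1, sub_eq_zero.2 h2⟩

/-- Each equation reads only finitely many coordinates, and coordinates are continuous on `ℓ²`. -/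
theorem SelkovData.continuous_defect (D : SelkovData) {L : ℝ}
    (hLip : ∀ (i : ℤ) (s₁ s₂ : ℝ), |D.σ i s₁ - D.σ i s₂| ≤ L * |s₁ - s₂|) (Δ : ℝ) (i : ℤ) :
    (Continuous fun z : (PhaseSpace × ℝ) × PhaseSpace => D.defect₁ Δ i z.1.1 z.1.2 z.2) ∧
      Continuous fun z : (PhaseSpace × ℝ) × PhaseSpace => D.defect₂ Δ i z.1.1 z.1.2 z.2 := by
  have hσ : Continuous (D.σ i) := (LipschitzWith.of_dist_le' (K := L) fun x y => by
      rw [Real.dist_eq, Real.dist_eq]; exact hLip i x y).continuous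
  have x₁ : Continuous fun z : (PhaseSpace × ℝ) × PhaseSpace => z.1.1.1 i :=
    (Ell2.continuous_apply i).comp (by fun_prop)
  have x₂ : Continuous fun z : (PhaseSpace × ℝ) × PhaseSpace => z.1.1.2 i :=
    (Ell2.continuous_apply i).comp (by fun_prop)
  have y₁ : ∀ j, Continuous fun z : (PhaseSpace × ℝ) × PhaseSpace => z.2.1 j := fun j =>
    (Ell2.continuous_apply j).comp (by fun_prop)
  have y₂ : ∀ j, Continuous fun z : (PhaseSpace × ℝ) × PhaseSpace => z.2.2 j := fun j =>
    (Ell2.continuous_apply j).comp (by fun_prop)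
  unfold SelkovData.defect₁ SelkovData.defect₂ laplacian
  constructor <;> fun_prop

/-- The bounded continuous function `min |g| 1` has integral zero along the family, hence in the
limit. -/
theorem ae_eq_zero_of_tendsto {X ι : Type*} [TopologicalSpace X] [MeasurableSpace X]
    [OpensMeasurableSpace X] {l : Filter ι} [l.NeBot] {Q : ι → ProbabilityMeasure X}
    {Q₀ : ProbabilityMeasure X} (hQ : Tendsto Q l (𝓝 Q₀)) {g : X → ℝ} (hg : Continuous g)
    (h : ∀ᶠ n in l, ∀ᵐ z ∂(Q n : Measure X), g z = 0) : ∀ᵐ z ∂(Q₀ : Measure X), g z = 0 := by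
  let G : X →ᵇ ℝ := BoundedContinuousFunction.ofNormedAddCommGroup (fun z => min |g z| 1)
    (by fun_prop) 1 (fun z => by
      rw [Real.norm_of_nonneg (le_min (abs_nonneg _) zero_le_one)]; exact min_le_right _ _)
  have hG : ∀ z, G z = min |g z| 1 := fun z => rfl
  have h1 := ProbabilityMeasure.tendsto_iff_forall_integral_tendsto.1 hQ G
  have h2 : (fun n => ∫ z, G z ∂(Q n : Measure X)) =ᶠ[l] fun _ => 0 := by
    filter_upwards [h] with n hn
    refine integral_eq_zero_of_ae ?_
    filter_upwards [hn] with z hz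
    simp [hG, hz]
  have h3 : ∫ z, G z ∂(Q₀ : Measure X) = 0 :=
    tendsto_nhds_unique h1 (tendsto_const_nhds.congr' h2.symm)
  have hG0 : 0 ≤ ⇑G := fun z => le_min (abs_nonneg _) zero_le_one
  rw [integral_eq_zero_iff_of_nonneg hG0 (G.integrable _)] at h3
  filter_upwards [h3] with z hz
  have hz' : min |g z| 1 = 0 := hz
  rcases min_choice |g z| 1 with hc | hc
  · rw [hc] at hz'; exact abs_eq_zero.1 hz'
  · rw [hc] at hz'; exact absurd hz' one_ne_zero

/-- The law of the Wiener increment. -/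
def increment (Δ : ℝ) : ProbabilityMeasure ℝ := ⟨gaussianReal 0 Δ.toNNReal, inferInstance⟩

/-- `Q` is the joint law of (state, increment, next state), with stationary states of law `m`,
solving the equations of the scheme at the sites `i` with `|i| < N`. -/
structure SelkovData.IsCoupling (D : SelkovData) (Δ : ℝ) (N : ℕ) (m : ProbabilityMeasure PhaseSpace)
    (Q : ProbabilityMeasure ((PhaseSpace × ℝ) × PhaseSpace)) : Prop where
  map_fst : Q.map measurable_fst.aemeasurable = m.prod (increment Δ)
  map_snd : Q.map measurable_snd.aemeasurable = m
  defect : ∀ i : ℤ, i.natAbs < N → ∀ᵐ z ∂(Q : Measure ((PhaseSpace × ℝ) × PhaseSpace)),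
    D.defect₁ Δ i z.1.1 z.1.2 z.2 = 0 ∧ D.defect₂ Δ i z.1.1 z.1.2 z.2 = 0

theorem SelkovData.exists_isCoupling (D : SelkovData) {Δ L : ℝ}
    (hLip : ∀ (i : ℤ) (s₁ s₂ : ℝ), |D.σ i s₁ - D.σ i s₂| ≤ L * |s₁ - s₂|) {N : ℕ}
    {m : ProbabilityMeasure PhaseSpace} (hm : m ∈ D.truncInvMeasures Δ N) :
    ∃ Q, D.IsCoupling Δ N m Q := by
  obtain ⟨ν, ⟨Ω, _, P, _, ψ₀, w, ψ₁, h0, hw, h1, e0, ew, hi, e1, hs⟩, hmν⟩ := hm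
  have hE := (continuous_embed N).measurable
  have hT : Measurable fun ω => ((embed N (ψ₀ ω), w ω), embed N (ψ₁ ω)) :=
    ((hE.comp h0).prodMk hw).prodMk (hE.comp h1)
  refine ⟨⟨P.map fun ω => ((embed N (ψ₀ ω), w ω), embed N (ψ₁ ω)),
    Measure.isProbabilityMeasure_map hT.aemeasurable⟩, ?_, ?_, ?_⟩
  · apply Subtype.ext
    change (P.map _).map Prod.fst = (m : Measure PhaseSpace).prod (gaussianReal 0 Δ.toNNReal)
    rw [Measure.map_map measurable_fst hT, hmν, ← e0, ← ew, Measure.map_map hE h0]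
    exact (indepFun_iff_map_prod_eq_prod_map_map (hE.comp h0).aemeasurable hw.aemeasurable).1
      (hi.comp hE measurable_id)
  · apply Subtype.ext
    change (P.map _).map Prod.snd = (m : Measure PhaseSpace)
    rw [Measure.map_map measurable_snd hT, hmν, ← e1, Measure.map_map hE h1]
    rfl
  · intro i hiN
    obtain ⟨c1, c2⟩ := D.continuous_defect hLip Δ i
    change ∀ᵐ z ∂(P.map _), _
    rw [ae_map_iff hT.aemeasurable]
    · filter_upwards [hs] with ω hω
      exact SelkovData.BEMStepTrunc.defect_eq_zero hω hiN
    · exact (measurableSet_eq_fun c1.measurable measurable_const).inter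
        (measurableSet_eq_fun c2.measurable measurable_const)

/-- Joint laws with tight marginals are tight, so Prokhorov's theorem yields a limit coupling, which
itself serves as the probability space witnessing invariance. -/
theorem SelkovData.exists_mem_invMeasures_tendsto (D : SelkovData) {Δ L : ℝ}
    (hLip : ∀ (i : ℤ) (s₁ s₂ : ℝ), |D.σ i s₁ - D.σ i s₂| ≤ L * |s₁ - s₂|)
    (htight : IsTightMeasureSet {m : Measure PhaseSpace | ∃ N : ℕ, 1 ≤ N ∧
      ∃ μ ∈ D.truncInvMeasures Δ N, m = (μ : Measure PhaseSpace)})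
    (𝓤 : Ultrafilter ℕ) (h𝓤 : (𝓤 : Filter ℕ) ≤ atTop) {m : ℕ → ProbabilityMeasure PhaseSpace}
    (hm : ∀ᶠ N in (𝓤 : Filter ℕ), m N ∈ D.truncInvMeasures Δ N) :
    ∃ μ ∈ D.invMeasures Δ, Tendsto m 𝓤 (𝓝 μ) := by
  set 𝒬 : Set (ProbabilityMeasure ((PhaseSpace × ℝ) × PhaseSpace)) :=
    {Q | ∃ N : ℕ, 1 ≤ N ∧ ∃ μ ∈ D.truncInvMeasures Δ N, D.IsCoupling Δ N μ Q}
  have h𝒬 : IsTightMeasureSet {((Q : ProbabilityMeasure ((PhaseSpace × ℝ) × PhaseSpace)) :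
      Measure ((PhaseSpace × ℝ) × PhaseSpace)) | Q ∈ 𝒬} := by
    refine IsTightMeasureSet.prodMk (IsTightMeasureSet.prodMk (htight.subset ?_)
      ((isTightMeasureSet_singleton (μ := (increment Δ : Measure ℝ))).subset ?_)) (htight.subset ?_)
    · rintro _ ⟨_, ⟨_, ⟨Q, ⟨N, hN, μ, hμ, hQ⟩, rfl⟩, rfl⟩, rfl⟩
      refine ⟨N, hN, μ, hμ, ?_⟩
      have : (Q : Measure ((PhaseSpace × ℝ) × PhaseSpace)).fst = (μ : Measure PhaseSpace).prod (increment Δ : Measure ℝ) :=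
        congrArg Subtype.val hQ.map_fst
      rw [this, Measure.fst_prod]
    · rintro _ ⟨_, ⟨_, ⟨Q, ⟨N, hN, μ, hμ, hQ⟩, rfl⟩, rfl⟩, rfl⟩
      have : (Q : Measure ((PhaseSpace × ℝ) × PhaseSpace)).fst = (μ : Measure PhaseSpace).prod (increment Δ : Measure ℝ) :=
        congrArg Subtype.val hQ.map_fst
      rw [this, Measure.snd_prod]
      rfl
    · rintro _ ⟨_, ⟨Q, ⟨N, hN, μ, hμ, hQ⟩, rfl⟩, rfl⟩
      exact ⟨N, hN, μ, hμ, congrArg Subtype.val hQ.map_snd⟩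
  have hQ : ∀ᶠ N in (𝓤 : Filter ℕ), ∃ Q, D.IsCoupling Δ N (m N) Q :=
    hm.mono fun N hN => D.exists_isCoupling hLip hN
  obtain ⟨Q, hQ⟩ := hQ.choice
  have hmem : ∀ᶠ N in (𝓤 : Filter ℕ), Q N ∈ closure 𝒬 := by
    filter_upwards [hQ, hm, h𝓤 (eventually_ge_atTop 1)] with N h1 h2 h3
    exact subset_closure ⟨N, h3, m N, h2, h1⟩
  obtain ⟨Q₀, -, hQ₀⟩ := isCompact_iff_ultrafilter_le_nhds.1
    (isCompact_closure_of_isTightMeasureSet h𝒬) (𝓤.map Q) (le_principal_iff.2 hmem)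
  have hlim : Tendsto Q 𝓤 (𝓝 Q₀) := hQ₀
  set μ := Q₀.map measurable_snd.aemeasurable with hμ
  have hmμ : Tendsto m 𝓤 (𝓝 μ) :=
    (ProbabilityMeasure.tendsto_map_of_tendsto_of_continuous Q Q₀ hlim continuous_snd).congr'
      (hQ.mono fun N h => h.map_snd)
  -- Independence survives because forming products of laws is weakly continuous.
  have hfst : Q₀.map measurable_fst.aemeasurable = μ.prod (increment Δ) := by
    refine tendsto_nhds_unique
      (ProbabilityMeasure.tendsto_map_of_tendsto_of_continuous Q Q₀ hlim continuous_fst) ?_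
    have h1 : Tendsto (fun N => (m N).prod (increment Δ)) 𝓤 (𝓝 (μ.prod (increment Δ))) :=
      (ProbabilityMeasure.continuous_prod.tendsto (μ, increment Δ)).comp
        (hmμ.prodMk_nhds tendsto_const_nhds)
    exact h1.congr' (hQ.mono fun N h => h.map_fst.symm)
  have hfst' : (Q₀ : Measure ((PhaseSpace × ℝ) × PhaseSpace)).map Prod.fst
      = (μ : Measure PhaseSpace).prod (increment Δ : Measure ℝ) := congrArg Subtype.val hfst
  have hm0 : Measurable fun z : (PhaseSpace × ℝ) × PhaseSpace => z.1.1 := by fun_prop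
  have hmw : Measurable fun z : (PhaseSpace × ℝ) × PhaseSpace => z.1.2 := by fun_prop
  have e0 : (Q₀ : Measure ((PhaseSpace × ℝ) × PhaseSpace)).map (fun z => z.1.1) = μ := by
    have := congrArg (Measure.map Prod.fst) hfst'
    rwa [Measure.map_map measurable_fst measurable_fst, Measure.map_fst_prod, measure_univ,
      one_smul] at this
  have ew : (Q₀ : Measure ((PhaseSpace × ℝ) × PhaseSpace)).map (fun z => z.1.2)
      = gaussianReal 0 Δ.toNNReal := by
    have := congrArg (Measure.map Prod.snd) hfst'
    rwa [Measure.map_map measurable_snd measurable_fst, Measure.map_snd_prod, measure_univ,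
      one_smul] at this
  -- A fixed site is eventually interior, so its equation holds along the ultrafilter.
  have hev : ∀ i : ℤ, ∀ᶠ N in (𝓤 : Filter ℕ), i.natAbs < N := fun i =>
    h𝓤 (eventually_gt_atTop i.natAbs)
  refine ⟨μ, ⟨(PhaseSpace × ℝ) × PhaseSpace, inferInstance, Q₀, inferInstance, fun z => z.1.1,
    fun z => z.1.2, Prod.snd, hm0, hmw, measurable_snd, e0, ew, ?_, rfl, ?_⟩, hmμ⟩
  · rw [indepFun_iff_map_prod_eq_prod_map_map hm0.aemeasurable hmw.aemeasurable, e0, ew]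
    exact hfst'
  · simp only [D.bemStep_iff_defect, eventually_and, ae_all_iff]
    refine ⟨fun i => ae_eq_zero_of_tendsto hlim (D.continuous_defect hLip Δ i).1 ?_,
      fun i => ae_eq_zero_of_tendsto hlim (D.continuous_defect hLip Δ i).2 ?_⟩
    · filter_upwards [hQ, hev i] with N h1 h2
      exact (h1.defect i h2).mono fun z hz => hz.1
    · filter_upwards [hQ, hev i] with N h1 h2
      exact (h1.defect i h2).mono fun z hz => hz.2

/-! ### Weak convergence in the weighted metric, and the conclusion -/

theorem SelkovData.normX_le (D : SelkovData) (hb₁ : 0 < D.b₁) (hb₂ : 0 < D.b₂) (ψ : PhaseSpace) :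
    D.normX ψ ≤ √(D.b₂ + D.b₁) * ‖ψ‖ := by
  unfold SelkovData.normX
  rw [← Real.sqrt_sq (norm_nonneg ψ), ← Real.sqrt_mul (by positivity)]
  refine Real.sqrt_le_sqrt ?_
  have h1 := pow_le_pow_left₀ (norm_nonneg _) (norm_fst_le ψ) 2
  have h2 := pow_le_pow_left₀ (norm_nonneg _) (norm_snd_le ψ) 2
  nlinarith

/-- On a separable space the Lévy-Prokhorov metric metrizes weak convergence, and the comparison
constant `c + 2` is the same for all admissible `φ`. -/
theorem SelkovData.eventually_distP_le (D : SelkovData) (hb₁ : 0 < D.b₁) (hb₂ : 0 < D.b₂)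
    {ι : Type*} {l : Filter ι} {m : ι → ProbabilityMeasure PhaseSpace}
    {μ : ProbabilityMeasure PhaseSpace} (h : Tendsto m l (𝓝 μ)) {ε : ENNReal} (hε : 0 < ε) :
    ∀ᶠ n in l, D.distP (m n) μ ≤ ε := by
  set c := √(D.b₂ + D.b₁)
  have hc : 0 ≤ c := Real.sqrt_nonneg _
  obtain ⟨r, hr, hrε⟩ : ∃ r : ℝ, 0 < r ∧ ENNReal.ofReal ((c + 2) * r) ≤ ε := by
    have h1 : Tendsto (fun r : ℝ => ENNReal.ofReal ((c + 2) * r)) (𝓝[>] 0) (𝓝 0) := by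
      have : Continuous fun r : ℝ => ENNReal.ofReal ((c + 2) * r) :=
        ENNReal.continuous_ofReal.comp (by fun_prop)
      simpa using (this.tendsto 0).mono_left nhdsWithin_le_nhds
    obtain ⟨r, h⟩ := (Eventually.and (self_mem_nhdsWithin (a := (0 : ℝ)) (s := Set.Ioi 0)) (h1.eventually_le_const hε)).exists
    exact ⟨r, h.1, h.2⟩
  have hLP := ((LevyProkhorov.probabilityMeasureHomeomorph (Ω := PhaseSpace)).continuous.tendsto
    μ).comp h
  rw [EMetric.tendsto_nhds] at hLP
  filter_upwards [hLP (ENNReal.ofReal r) (ENNReal.ofReal_pos.2 hr)] with n hn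
  have hd : levyProkhorovEDist (m n : Measure PhaseSpace) μ < ENNReal.ofReal r := hn
  refine iSup₂_le fun φ hφ => le_trans (ENNReal.ofReal_le_ofReal ?_) hrε
  obtain ⟨M, K, hMK, hK, hφM, hφK⟩ := hφ
  have hM : 0 ≤ M := (abs_nonneg _).trans (hφM 0)
  have hLip : ∀ x y, |φ x - φ y| ≤ c * dist x y := fun x y => by
    rw [dist_eq_norm]
    calc |φ x - φ y| ≤ K * D.normX (x - y) := hφK x y
      _ ≤ 1 * (c * ‖x - y‖) :=
        mul_le_mul (by linarith) (D.normX_le hb₁ hb₂ _) (Real.sqrt_nonneg _) zero_le_one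
      _ = _ := one_mul _
  have h1 := integral_sub_le_of_levyProkhorovEDist_lt _ _ hr hd hM hc hφM hLip
  have h2 := integral_sub_le_of_levyProkhorovEDist_lt _ _ hr
    (by rwa [levyProkhorovEDist_comm]) hM hc hφM hLip
  have h3 : (c + 2 * M) * r ≤ (c + 2) * r := mul_le_mul_of_nonneg_right (by linarith) hr.le
  rw [abs_le]
  constructor <;> linarith

end LatticeSelkov

end

theorem theorem5p2 (D : LatticeSelkov.SelkovData) (hp : 1 ≤ D.p)
    (hd₁ : 0 < D.d₁) (hd₂ : 0 < D.d₂) (ha₁ : 0 < D.a₁) (ha₂ : 0 < D.a₂)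
    (hb₁ : 0 < D.b₁) (hb₂ : 0 < D.b₂)
    (L β : ℝ) (δ : LatticeSelkov.Ell2) (hL : 0 < L)
    (hLip : ∀ (i : ℤ) (s₁ s₂ : ℝ), |D.σ i s₁ - D.σ i s₂| ≤ L * |s₁ - s₂|)
    (hgrowth : ∀ (i : ℤ) (s : ℝ), |D.σ i s| ≤ δ i + β * |s|)
    (hdiss : 16 * β ^ 2 < min D.a₁ D.a₂) :
    ∃ Δ₀ : ℝ, 0 < Δ₀ ∧ ∀ Δ : ℝ, 0 < Δ → Δ < Δ₀ →
      Tendsto (fun N : ℕ => D.semidistP (D.truncInvMeasures Δ N) (D.invMeasures Δ))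
        atTop (𝓝 0) := by
  -- The estimates hold for every positive `Δ`; the threshold `1` is arbitrary.
  refine ⟨1, one_pos, fun Δ hΔ _ => ?_⟩
  have htight := D.isTight_truncInvMeasures hd₁ hd₂ ha₁ ha₂ hb₁ hb₂ hLip hgrowth hdiss hΔ
  rw [ENNReal.tendsto_nhds_zero]
  by_contra hcon
  push Not at hcon
  obtain ⟨ε, hε, hfreq⟩ := hcon
  let bad : Set ℕ := {N | ∃ μ, μ ∈ D.truncInvMeasures Δ N ∧
    ∀ ν ∈ D.invMeasures Δ, ε < D.distP μ ν}
  have hbad : ∃ᶠ N in atTop, N ∈ bad := by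
    refine hfreq.mono fun N hN => ?_
    simp only [LatticeSelkov.SelkovData.semidistP, lt_iSup_iff] at hN
    obtain ⟨μ, hμ, hlt⟩ := hN
    exact ⟨μ, hμ, fun ν hν => hlt.trans_le (iInf₂_le ν hν)⟩
  have : (atTop ⊓ 𝓟 bad).NeBot := frequently_mem_iff_neBot.1 hbad
  -- An ultrafilter on the bad indices replaces extraction of a subsequence. An empty `S^Δ` needs no
  -- separate case: the limit found below belongs to it.
  let 𝓤 := Ultrafilter.of (atTop ⊓ 𝓟 bad)
  have h𝓤 : (𝓤 : Filter ℕ) ≤ atTop ⊓ 𝓟 bad := Ultrafilter.of_le _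
  have hev : ∀ᶠ N in (𝓤 : Filter ℕ), ∃ μ, μ ∈ D.truncInvMeasures Δ N ∧
      ∀ ν ∈ D.invMeasures Δ, ε < D.distP μ ν :=
    le_principal_iff.1 (h𝓤.trans inf_le_right)
  have : Nonempty (ProbabilityMeasure LatticeSelkov.PhaseSpace) := ⟨hev.exists.choose_spec.choose⟩
  obtain ⟨m, hm⟩ := hev.choice
  obtain ⟨μ, hμ, hlim⟩ := D.exists_mem_invMeasures_tendsto hLip htight 𝓤 (h𝓤.trans inf_le_left)
    (hm.mono fun N h => h.1)
  obtain ⟨N, h1, h2⟩ := (hm.and (D.eventually_distP_le hb₁ hb₂ hlim hε)).exists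
  exact absurd (h1.2 μ hμ) (not_lt.2 h2)
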